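/- Let $N\ge 0$, $a_1,\dots,a_N,w_1,\dots,w_N\in\mathbb C$ with $\Re w_k\neq 0$ for all $k$, and let $$g(t)=\sum_{k=1}^N\frac{a_k}{t-iw_k},\qquad m_0(\xi)=\sum_{k=1}^N a_k e^{2\pi\xi w_k}.$$ Assume that $g$ belongs to the Wiener amalgam space $W_0$, i.e. $g$ is continuous on $\mathbb R$ and $\sum_{k\in\mathbb Z}\max_{x\in[k,k+1]}|g(x)|<\infty$, and that $m_0(\xi)\ne 0$ for all $\xi>0$. For $c=\{c_k\}\in\ell^2(\mathbb Z)$ put $f_c(t)=\sum_{k\in\mathbb Z}c_k\,g(t-k)$, and let $V^2(g)=\{f_c: c\in\ell^2(\mathbb Z)\}$. A set $\Lambda\subset\mathbb R$ is called separated if for some $\delta>0$ any two distinct points of $\Lambda$ are at distance greater than $\delta$; a separated set $\Lambda$ is called sampling for $V^2(g)$ if there are $A,B>0$ with $A\|f\|_{L^2}^2\le\sum_{\lambda\in\Lambda}|f(\lambda)|^2\le B\|f\|_{L^2}^2$ for all $f\in V^2(g)$. Let $\alpha\in(0,1)$. Then: 1. For every $c\in\ell^2(\mathbb Z)$ the series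 defining $f_c$ converges absolutely at every $t\in\mathbb R$, and $f_c\in L^2(\mathbb R)$. 2. There is $B_\alpha>0$ such that for every $c\in\ell^2(\mathbb Z)$ $$\sum_{k\in\mathbb Z}|f_c(\alpha k)|^2\le B_\alpha\|c\|_{\ell^2}^2\quad\text{and}\quad \sum_{k\in\mathbb Z}|f_c(\alpha k)|^2\le B_\alpha\|f_c\|_{L^2}^2 .$$ 3. If $\alpha$ is irrational, then $\alpha\mathbb Z$ is a sampling set for $V^2(g)$, and there are $A_\alpha,B_\alpha>0$ such that for every $c\in\ell^2(\mathbb Z)$ $$A_\alpha\|c\|_{\ell^2}^2\le\sum_{k\in\mathbb Z}|f_c(\alpha k)|^2\le B_\alpha\|c\|_{\ell^2}^2 .$$ -/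

import Mathlib

open MeasureTheory

noncomputable section

/-- The rational window `g(t) = ∑ₖ aₖ / (t - i wₖ)`. -/
def rationalWindow {N : ℕ} (a w : Fin N → ℂ) (t : ℝ) : ℂ :=
  ∑ k, a k / ((t : ℂ) - Complex.I * w k)

/-- The exponential polynomial `m₀(ξ) = ∑ₖ aₖ e^{2πξwₖ}`. -/
def mZero {N : ℕ} (a w : Fin N → ℂ) (ξ : ℝ) : ℂ :=
  ∑ k, a k * Complex.exp (2 * (Real.pi : ℂ) * (ξ : ℂ) * w k)

/-- The Wiener amalgam space `W₀ = W(ℓ¹, ℂ)`: continuous functions `g` with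
`∑_{k ∈ ℤ} max_{x ∈ [k, k+1]} |g(x)| < ∞`. -/
def MemWienerAmalgam (g : ℝ → ℂ) : Prop :=
  Continuous g ∧
    Summable fun k : ℤ => sSup ((fun x : ℝ => ‖g x‖) '' Set.Icc (k : ℝ) ((k : ℝ) + 1))

/-- The function `f(t) = ∑_{k ∈ ℤ} c_k g(t - k)`, for `c ∈ ℓ²(ℤ)`. -/
def shiftSeries (g : ℝ → ℂ) (c : lp (fun _ : ℤ => ℂ) 2) (t : ℝ) : ℂ :=
  ∑' k : ℤ, c k * g (t - k)

/-- The shift-invariant space `V²(g)`. -/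
def shiftInvariantSpace (g : ℝ → ℂ) : Set (ℝ → ℂ) :=
  Set.range (shiftSeries g)

/-- A separated subset of the real line. -/
def IsSeparatedSet (Λ : Set ℝ) : Prop :=
  ∃ δ : ℝ, 0 < δ ∧ ∀ x ∈ Λ, ∀ y ∈ Λ, x ≠ y → δ < |x - y|

/-- `Λ` is sampling for a space `V` of square integrable functions: it is separated, and
`A ‖f‖₂² ≤ ∑_{λ ∈ Λ} |f(λ)|² ≤ B ‖f‖₂²` on `V`. Square integrability of `f` and convergence of
the sum over `Λ` are part of the claim. -/
def IsSamplingSet (V : Set (ℝ → ℂ)) (Λ : Set ℝ) : Prop :=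
  IsSeparatedSet Λ ∧
    ∃ A B : ℝ, 0 < A ∧ 0 < B ∧ ∀ f ∈ V,
      MemLp f 2 volume ∧
      Summable (fun l : Λ => ‖f l‖ ^ 2) ∧
      A * ∫ t, ‖f t‖ ^ 2 ≤ ∑' l : Λ, ‖f l‖ ^ 2 ∧
      ∑' l : Λ, ‖f l‖ ^ 2 ≤ B * ∫ t, ‖f t‖ ^ 2

end

open Filter Topology

/-! Put `β = 1/α > 1`. For finite `c`, let `φ(y) = ∑ c_l e^{2πi(x-l)y}`, whose mean square over a
unit interval is `∑ |c_l|²`. The samples `f_c(x - αn)` are, up to a constant factor, the Fourier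
coefficients on `(0, β]` of a function `G` (`fourierCoeffOn_trigState`). This `G` is the output of a
linear system with exponents `w_k` that receives the input `φ(ξ - nβ)` at step `n`. By Parseval, the
lower bound reduces to recovering the inputs from boundedly many values of `G`
(`exists_local_bound`).

The response to one input, at distance `τ` after it enters, is `m₀(τ)`. Once the initial state is
controlled, the inputs follow one at a time, because `|m₀|` is bounded below on `[β - 1, β]`
(`exists_input_bound`). The initial state is recovered from finitely many outputs when the phase `θ`
lies in a suitable interval (`exists_window_bound`). There the unknowns satisfy a linear system
analytic in `θ`. Along a complex ray its renormalized form tends to a system with a single dominant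
exponential in the responses, which is injective (`limit_system_unique`). Hence the original system
is injective off isolated phases (`eventually_matrix_bound`). Irrationality of `β` gives this
injectivity and also brings every orbit into the good interval in bounded time
(`exists_uniform_return_time`).

The upper bounds are a Schur test. It also allows passage from finite to square-summable `c`.
Integrating the bounds for all translates of an auxiliary irrational lattice shows that `‖f_c‖₂` and
`‖c‖` are comparable, which covers rational `α` as well. -/

/-- The exponential polynomial `∑ₖ aₖ e^{2πzwₖ}` as a function of a complex variable. -/
noncomputable def expSum {N : ℕ} (a w : Fin N → ℂ) (z : ℂ) : ℂ :=
  ∑ k, a k * Complex.exp (2 * (Real.pi : ℂ) * z * w k)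

theorem differentiable_expSum {N : ℕ} (a w : Fin N → ℂ) : Differentiable ℂ (expSum a w) := by
  unfold expSum
  fun_prop

/-! ### Dominant exponents and uniqueness for the limiting system -/

/-- Along a suitable ray an exponential polynomial is asymptotic to one of its terms. -/
theorem exists_dominant_exponent {N : ℕ} (a w : Fin N → ℂ) (hm : ∃ z, expSum a w z ≠ 0) :
    ∃ ω ∈ Set.range w, ∃ b : ℂ, b ≠ 0 ∧ ∃ d : ℂ, ∀ s : ℂ,
      Tendsto (fun t : ℝ => Complex.exp (-(2 * (Real.pi : ℂ) * (t * d) * ω)) *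
        expSum a w (t * d + s)) atTop (𝓝 (b * Complex.exp (2 * (Real.pi : ℂ) * s * ω))) := by
  classical
  let W : Finset ℂ := Finset.univ.image w
  let b : ℂ → ℂ := fun ω => ∑ k with w k = ω, a k
  have hsum : ∀ z, expSum a w z = ∑ ω ∈ W, b ω * Complex.exp (2 * (Real.pi : ℂ) * z * ω) := by
    intro z
    unfold expSum
    rw [← Finset.sum_fiberwise_of_maps_to (g := w) (t := W)
      (fun k _ => Finset.mem_image_of_mem w (Finset.mem_univ k))]
    refine Finset.sum_congr rfl fun ω _ => ?_
    rw [Finset.sum_mul]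
    refine Finset.sum_congr rfl fun k hk => ?_
    rw [(Finset.mem_filter.1 hk).2]
  have hne : (W.filter fun ω => b ω ≠ 0).Nonempty := by
    by_contra h
    rw [Finset.not_nonempty_iff_eq_empty] at h
    obtain ⟨z, hz⟩ := hm
    refine hz ?_
    rw [hsum]
    refine Finset.sum_eq_zero fun ω hω => ?_
    have : b ω = 0 := by
      by_contra hb
      have : ω ∈ W.filter fun ω => b ω ≠ 0 := Finset.mem_filter.2 ⟨hω, hb⟩
      simp [h] at this
    rw [this, zero_mul]
  obtain ⟨ω, hω, hmax⟩ := Finset.exists_max_image _ (fun z : ℂ => ‖z‖) hne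
  obtain ⟨hωW, hbω⟩ := Finset.mem_filter.1 hω
  obtain ⟨k, -, hk⟩ := Finset.mem_image.1 hωW
  -- Here `ω` has maximal modulus among the exponents whose collected coefficient is nonzero. In the
  -- direction `conj ω`, every other such `η` loses: `2 Re(conj ω (η - ω)) = |η|² - |ω|² - |η - ω|²
  -- < 0`.
  refine ⟨ω, ⟨k, hk⟩, b ω, hbω, (starRingEnd ℂ) ω, fun s => ?_⟩
  have key : ∀ η ∈ W, Tendsto (fun t : ℝ =>
      b η * Complex.exp (2 * (Real.pi : ℂ) * s * η) *
        Complex.exp (2 * (Real.pi : ℂ) * t * ((starRingEnd ℂ) ω * (η - ω)))) atTop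
      (𝓝 (if η = ω then b ω * Complex.exp (2 * (Real.pi : ℂ) * s * ω) else 0)) := by
    intro η hη
    by_cases h1 : η = ω
    · subst h1
      simp
    rw [if_neg h1]
    by_cases h2 : b η = 0
    · simp [h2]
    have hle : ‖η‖ ≤ ‖ω‖ := hmax η (Finset.mem_filter.2 ⟨hη, h2⟩)
    have hneg : ((starRingEnd ℂ) ω * (η - ω)).re < 0 := by
      have h3 : 0 < Complex.normSq (η - ω) := Complex.normSq_pos.2 (sub_ne_zero.2 h1)
      have h4 : Complex.normSq η ≤ Complex.normSq ω := by
        rw [Complex.normSq_eq_norm_sq, Complex.normSq_eq_norm_sq]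
        gcongr
      simp only [Complex.normSq_apply, Complex.sub_re, Complex.sub_im] at h3 h4
      simp only [Complex.mul_re, Complex.conj_re, Complex.conj_im, Complex.sub_re, Complex.sub_im]
      nlinarith
    rw [← mul_zero (b η * Complex.exp (2 * (Real.pi : ℂ) * s * η))]
    refine Tendsto.const_mul _ ?_
    rw [tendsto_zero_iff_norm_tendsto_zero]
    simp only [Complex.norm_exp]
    have : ∀ t : ℝ, (2 * (Real.pi : ℂ) * t * ((starRingEnd ℂ) ω * (η - ω))).re =
        (2 * Real.pi * ((starRingEnd ℂ) ω * (η - ω)).re) * t := by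
      intro t
      rw [show (2 * (Real.pi : ℂ) * t) = ((2 * Real.pi * t : ℝ) : ℂ) by push_cast; ring,
        Complex.re_ofReal_mul]
      ring
    simp only [this]
    refine Real.tendsto_exp_atBot.comp ?_
    refine Tendsto.const_mul_atTop_of_neg ?_ tendsto_id
    exact mul_neg_of_pos_of_neg (by positivity) hneg
  have h := tendsto_finsetSum W key
  rw [Finset.sum_ite_eq' W ω, if_pos hωW] at h
  refine h.congr fun t => ?_
  rw [hsum, Finset.mul_sum]
  refine Finset.sum_congr rfl fun η _ => ?_
  rw [mul_left_comm (Complex.exp _) (b η), mul_assoc, ← Complex.exp_add, ← Complex.exp_add]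
  ring_nf

/-- An exponential sum with distinct bases which vanishes at enough consecutive integers is
trivial. -/
theorem eq_zero_of_forall_sum_mul_pow_eq_zero (Λ : Finset ℂ) (f v : ℂ → ℂ)
    (hf : Set.InjOn f Λ) (h : ∀ i < Λ.card, ∑ l ∈ Λ, v l * f l ^ i = 0) :
    ∀ l ∈ Λ, v l = 0 := by
  let e := Λ.equivFin.symm
  have h0 : (fun j => v (e j)) = 0 := by
    refine Matrix.eq_zero_of_forall_pow_sum_mul_pow_eq_zero (f := fun j => f (e j)) ?_ ?_
    · intro i j hij
      exact e.injective (Subtype.ext (hf (e i).2 (e j).2 hij))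
    · intro i
      rw [← h i i.2, ← Finset.sum_coe_sort Λ]
      exact Equiv.sum_comp e (fun l : Λ => v l * f l ^ (i : ℕ))
  intro l hl
  simpa [e] using congrFun h0 (e.symm ⟨l, hl⟩)

/-- Exponents `q` for which `λ ↦ λ ^ q` is injective on a finite set. -/
theorem exists_injOn_pow (Λ : Finset ℂ) (h0 : ∀ l ∈ Λ, l ≠ 0) :
    ∃ D : ℕ, 2 ≤ D ∧ ∀ s : ℤ, Set.InjOn (fun l : ℂ => l ^ (1 + D * s : ℤ).natAbs) Λ := by
  classical
  let o : ℂ × ℂ → ℕ := fun p => if orderOf (p.1 / p.2) = 0 then 1 else orderOf (p.1 / p.2)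
  have ho : ∀ p, o p ≠ 0 := by
    intro p
    simp only [o]
    split_ifs with h
    · exact one_ne_zero
    · exact h
  -- Modulo the order of any ratio that is a root of unity, `1 + D s` is `1`, so its power cannot
  -- kill a nontrivial ratio. The factor 2 keeps `1 + D s` nonzero, which settles the ratios of
  -- infinite order.
  refine ⟨2 * ∏ p ∈ Λ ×ˢ Λ, o p, ?_, ?_⟩
  · have : ∏ p ∈ Λ ×ˢ Λ, o p ≠ 0 := Finset.prod_ne_zero_iff.2 fun p _ => ho p
    omega
  · intro s x hx y hy hxy
    have hy0 := h0 y hy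
    set D := 2 * ∏ p ∈ Λ ×ˢ Λ, o p with hD
    have h1 : (x / y) ^ (1 + D * s : ℤ).natAbs = 1 := by
      rw [div_pow, div_eq_one_iff_eq (pow_ne_zero _ hy0)]
      exact hxy
    have h2 := Int.natCast_dvd.2 (orderOf_dvd_of_pow_eq_one h1)
    by_cases h3 : orderOf (x / y) = 0
    · rw [h3] at h2
      have h4 : (1 + (D : ℤ) * s) = 0 := by simpa using h2
      have h5 : (2 : ℤ) ∣ D := by rw [hD]; push_cast; exact dvd_mul_right _ _
      have h6 : (2 : ℤ) ∣ D * s := h5.mul_right s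
      omega
    · have h5 : orderOf (x / y) ∣ D := by
        have : o (x, y) = orderOf (x / y) := if_neg h3
        rw [hD, ← this]
        exact (Finset.dvd_prod_of_mem o (Finset.mk_mem_product hx hy)).mul_left 2
      have h6 : (orderOf (x / y) : ℤ) ∣ 1 := by
        have := (Int.natCast_dvd_natCast.2 h5).mul_right s
        exact (dvd_add_left this).1 h2
      have h7 : orderOf (x / y) = 1 := by
        have := Int.natCast_dvd_natCast.1 (by simpa using h6 : (orderOf (x / y) : ℤ) ∣ (1 : ℕ))
        exact Nat.dvd_one.1 this
      rw [orderOf_eq_one_iff] at h7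
      exact (div_eq_one_iff_eq hy0).1 h7

theorem exists_small_int_combination {x y : ℝ} (hxy : Irrational (x / y)) (z : ℝ) {ε : ℝ}
    (hε : 0 < ε) : ∃ p q : ℤ, |p * x + q * y - z| < ε := by
  have hd := dense_addSubgroupClosure_pair_iff.2 hxy
  obtain ⟨v, hv, hv2⟩ := hd.exists_dist_lt z hε
  obtain ⟨p, q, rfl⟩ := AddSubgroup.mem_closure_pair.1 hv
  refine ⟨p, q, ?_⟩
  rw [Real.dist_eq, abs_sub_comm] at hv2
  simpa using hv2

/-- Lattice crossings of a sampling sequence of irrational spacing avoid the members of a long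
arithmetic progression. -/
theorem exists_progression_without_crossing (Λ : Finset ℂ) (h0 : ∀ l ∈ Λ, l ≠ 0) {β θ : ℝ}
    (hβ : Irrational β) (hθ0 : 0 < θ) (hθ1 : θ < β - 1) (r : ℕ) :
    ∃ q : ℕ, Set.InjOn (fun l : ℂ => l ^ q) Λ ∧ ∀ k : ℕ, k ≤ r → ∀ i : ℕ,
      ((i : ℝ) + 1) * β < θ + (q * k : ℕ) + 1 → ((i : ℝ) + 1) * β < θ + (q * k : ℕ) := by
  obtain ⟨D, hD, hinj⟩ := exists_injOn_pow Λ h0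
  have hirr : Irrational ((D : ℝ) / β) := by
    have := (irrational_inv_iff.2 hβ).natCast_mul (show D ≠ 0 by omega)
    simpa [div_eq_mul_inv] using this
  -- If `q` is within `ε` of a multiple of `β`, then `q k` with `k ≤ r` drifts from `βℤ` by less
  -- than both `θ` and `β - 1 - θ`.
  set ε := min θ (β - 1 - θ) / (r + 1) with hε
  have hεpos : 0 < ε := div_pos (lt_min hθ0 (by linarith)) (by positivity)
  obtain ⟨s, p, hsp⟩ := exists_small_int_combination hirr (-1) hεpos
  obtain ⟨p', hp'⟩ : ∃ p' : ℤ, |(((1 + D * s : ℤ).natAbs : ℕ) : ℝ) - p' * β| < ε := by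
    rcases Int.natAbs_eq (1 + D * s : ℤ) with h | h
    · refine ⟨-p, ?_⟩
      have h' : (((1 + D * s : ℤ).natAbs : ℕ) : ℝ) = 1 + D * s := by
        rw [← Int.cast_natCast, ← h]
        push_cast
        ring
      rw [h']
      convert hsp using 2
      push_cast
      ring
    · refine ⟨p, ?_⟩
      have h' : (((1 + D * s : ℤ).natAbs : ℕ) : ℝ) = -(1 + D * s) := by
        have : (((1 + D * s : ℤ).natAbs : ℕ) : ℤ) = -(1 + D * s) := by omega
        rw [← Int.cast_natCast, this]
        push_cast
        ring
      rw [h', ← abs_neg]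
      convert hsp using 2
      ring
  set q := (1 + D * s : ℤ).natAbs
  refine ⟨q, hinj s, fun k hk i hi => ?_⟩
  have hβ1 : 1 < β := by linarith
  have hkε : k * ε < min θ (β - 1 - θ) := by
    have hk' : (k : ℝ) < r + 1 := by
      have : (k : ℝ) ≤ r := by exact_mod_cast hk
      linarith
    calc k * ε < (r + 1) * ε := by gcongr
      _ = min θ (β - 1 - θ) := by rw [hε]; field_simp
  have h1 := lt_of_lt_of_le hkε (min_le_left _ _)
  have h2 := lt_of_lt_of_le hkε (min_le_right _ _)
  obtain ⟨h3, h4⟩ := abs_lt.1 hp'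
  have hk0 : (0 : ℝ) ≤ k := by positivity
  have h5 : (k : ℝ) * (q - p' * β) ≤ k * ε := by gcongr
  have h6 : (k : ℝ) * -ε ≤ k * (q - p' * β) := by gcongr
  push_cast at hi ⊢
  -- The lattice point `p' k β` lies below `θ + q k`, and its successor lies beyond `θ + q k + 1`.
  have h7 : ((i : ℝ) + 1) * β < (p' * k + 1) * β := by nlinarith
  have h8 : ((i : ℝ) + 1) < p' * k + 1 := lt_of_mul_lt_mul_right h7 (by linarith)
  have h9 : ((i : ℤ) + 1) < p' * k + 1 := by exact_mod_cast h8
  have h10 : ((i : ℤ) + 1) ≤ p' * k := by omega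
  have h11 : ((i : ℝ) + 1) ≤ p' * k := by exact_mod_cast h10
  nlinarith

/-- Uniqueness for the limiting system, in which a single exponential is fed by the input `u`. -/
theorem limit_system_unique (Λ : Finset ℂ) (h0 : ∀ l ∈ Λ, l ≠ 0) {l₁ : ℂ} (hl₁ : l₁ ∈ Λ)
    {β θ : ℝ} (hβ : Irrational β) (hθ0 : 0 < θ) (hθ1 : θ < β - 1) (hθ2 : θ < 1) :
    ∃ J : ℕ, ∀ S : ℂ → ℂ, ∀ u : ℕ → ℂ,
      (∀ j ≤ J, ∑ l ∈ Λ, l ^ j * S l +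
        ∑ i ∈ Finset.range (J + 1) with (((i : ℕ) : ℝ) + 1) * β < θ + (j : ℕ), l₁ ^ j * u i = 0) →
      (∀ l ∈ Λ, S l = 0) ∧ ∀ i ∈ Finset.range (J + 1), ((i : ℝ) + 1) * β < θ + J → u i = 0 := by
  obtain ⟨q, hq, hcross⟩ := exists_progression_without_crossing Λ h0 hβ hθ0 hθ1 Λ.card
  have hβ1 : 1 < β := by linarith
  have hl₁0 := h0 l₁ hl₁
  refine ⟨q * Λ.card + 1, fun S u h => ?_⟩
  set J := q * Λ.card + 1
  let X : ℕ → Finset ℕ := fun j =>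
    (Finset.range (J + 1)).filter fun i : ℕ => ((i : ℝ) + 1) * β < θ + (j : ℕ)
  -- After division by `l₁ ^ j`, an input contributes the same constant from the moment it enters.
  have hX : ∀ j ≤ J, ∑ l ∈ Λ, S l * (l / l₁) ^ j + ∑ i ∈ X j, u i = 0 := by
    intro j hj
    have := h j hj
    rw [← Finset.mul_sum] at this
    have h2 : ∑ l ∈ Λ, l ^ j * S l = l₁ ^ j * ∑ l ∈ Λ, S l * (l / l₁) ^ j := by
      rw [Finset.mul_sum]
      refine Finset.sum_congr rfl fun l _ => ?_
      rw [div_pow]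
      field_simp
    rw [h2, ← mul_add] at this
    exact (mul_eq_zero.1 this).resolve_left (pow_ne_zero _ hl₁0)
  -- No input enters between `q k` and `q k + 1`, so subtracting the two equations removes all
  -- inputs. What remains is a Vandermonde system with the distinct nodes `(l / l₁) ^ q`.
  have hS : ∀ l ∈ Λ, S l * (l / l₁ - 1) = 0 := by
    refine eq_zero_of_forall_sum_mul_pow_eq_zero Λ (fun l => (l / l₁) ^ q) _ ?_ ?_
    · intro x hx y hy hxy
      refine hq hx hy ?_
      simp only [div_pow] at hxy
      exact (div_left_inj' (pow_ne_zero _ hl₁0)).1 hxy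
    · intro k hk
      have hqk : q * k + 1 ≤ J := by
        have : q * k ≤ q * Λ.card := Nat.mul_le_mul_left _ hk.le
        omega
      have e1 := hX (q * k) (by omega)
      have e2 := hX (q * k + 1) hqk
      have e3 : X (q * k + 1) = X (q * k) := by
        refine Finset.filter_congr fun i _ => ⟨fun hi => ?_, fun hi => ?_⟩
        · exact hcross k hk.le i (by push_cast at hi ⊢; linarith)
        · push_cast at hi ⊢; linarith
      rw [e3] at e2
      have e4 : ∑ l ∈ Λ, S l * (l / l₁ - 1) * ((l / l₁) ^ q) ^ k =
          ∑ l ∈ Λ, S l * (l / l₁) ^ (q * k + 1) - ∑ l ∈ Λ, S l * (l / l₁) ^ (q * k) := by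
        rw [← Finset.sum_sub_distrib]
        refine Finset.sum_congr rfl fun l _ => ?_
        rw [← pow_mul, pow_succ]
        ring
      rw [e4]
      linear_combination e2 - e1
  have hS1 : ∀ l ∈ Λ, l ≠ l₁ → S l = 0 := by
    intro l hl hne
    refine (mul_eq_zero.1 (hS l hl)).resolve_right ?_
    exact fun h3 => hne ((div_eq_one_iff_eq hl₁0).1 (sub_eq_zero.1 h3))
  have hsum : ∀ j, ∑ l ∈ Λ, S l * (l / l₁) ^ j = S l₁ := by
    intro j
    rw [Finset.sum_eq_single_of_mem l₁ hl₁ fun l hl hne => by rw [hS1 l hl hne, zero_mul],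
      div_self hl₁0, one_pow, mul_one]
  have hS2 : S l₁ = 0 := by
    have e := hX 0 (by omega)
    rw [hsum] at e
    have : X 0 = ∅ := by
      refine Finset.filter_eq_empty_iff.2 fun i _ => ?_
      have : (0 : ℝ) ≤ i := by positivity
      push_cast
      nlinarith
    simpa [this] using e
  refine ⟨fun l hl => ?_, fun i => ?_⟩
  · by_cases hne : l = l₁
    · rw [hne, hS2]
    · exact hS1 l hl hne
  · induction i using Nat.strong_induction_on with
    | _ i ih =>
      intro hi hiJ
      -- At the first sample after the `i`-th entry, the next input has not entered because `β > 1`,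
      -- so `u i` is the only unknown left.
      have hex : ∃ j : ℕ, ((i : ℝ) + 1) * β < θ + j := ⟨J, hiJ⟩
      classical
      set j := Nat.find hex with hj
      have hj1 : ((i : ℝ) + 1) * β < θ + j := Nat.find_spec hex
      have hjJ : j ≤ J := Nat.find_min' hex hiJ
      have hj2 : θ + j ≤ ((i : ℝ) + 1) * β + 1 := by
        rcases Nat.eq_zero_or_pos j with h4 | h4
        · rw [h4]
          have : (0 : ℝ) ≤ i := by positivity
          push_cast
          nlinarith
        · have := Nat.find_min hex (show j - 1 < Nat.find hex by omega)
          rw [not_lt, Nat.cast_sub h4] at this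
          push_cast at this
          linarith
      have e := hX j hjJ
      rw [hsum, hS2, zero_add] at e
      rw [Finset.sum_eq_single_of_mem i (Finset.mem_filter.2 ⟨hi, hj1⟩)] at e
      · exact e
      · intro i' hi' hne
        obtain ⟨h5, h6⟩ := Finset.mem_filter.1 hi'
        have h7 : i' < i := by
          have h8 : ((i' : ℝ) + 1) * β < (i + 2) * β := by nlinarith
          have h9 : ((i' : ℝ) + 1) < i + 2 := lt_of_mul_lt_mul_right h8 (by linarith)
          have h10 : i' + 1 < i + 2 := by exact_mod_cast h9
          omega
        refine ih i' h7 h5 ?_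
        have : (i' : ℝ) < i := by exact_mod_cast h7
        nlinarith

/-! ### Recovering the state from a window of outputs -/

/-- An entire family of matrices with an injective limit along a ray is locally uniformly injective
near almost all real parameters. -/
theorem eventually_matrix_bound {ι κ : Type*} [Fintype ι] [DecidableEq ι] [Fintype κ]
    [DecidableEq κ] (A : ℂ → Matrix ι κ ℂ) (hA : ∀ i j, Differentiable ℂ fun z => A z i j)
    (A' : Matrix ι κ ℂ) (d : ℂ)
    (hlim : ∀ i j, Tendsto (fun t : ℝ => A (t * d) i j) atTop (𝓝 (A' i j)))
    (hinj : ∀ v, A'.mulVec v = 0 → v = 0) (x : ℝ) :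
    ∀ᶠ y : ℝ in 𝓝[≠] x, ∃ K : ℝ, 0 ≤ K ∧ ∀ᶠ y' : ℝ in 𝓝 y, ∀ v : κ → ℂ, ∀ C : ℝ, 0 ≤ C →
      (∀ i, ‖(A y').mulVec v i‖ ≤ C) → ∀ j, ‖v j‖ ≤ K * C := by
  obtain ⟨L, hL⟩ : ∃ L : Matrix κ ι ℂ, L * A' = 1 := by
    have hker : LinearMap.ker (Matrix.toLin' A') = ⊥ := by
      rw [LinearMap.ker_eq_bot']
      intro v hv
      exact hinj v (by simpa using hv)
    obtain ⟨g, hg⟩ := LinearMap.exists_leftInverse_of_injective _ hker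
    refine ⟨LinearMap.toMatrix' g, ?_⟩
    have := congrArg LinearMap.toMatrix' hg
    rwa [LinearMap.toMatrix'_comp, LinearMap.toMatrix'_toLin', LinearMap.toMatrix'_id] at this
  -- With `L` a left inverse of the limit, `det (L * A z)` is entire and tends to 1 along the ray.
  -- It is therefore not identically zero and its zeros are isolated. Off them `(L * A z)⁻¹ * L` is
  -- a continuous left inverse of `A z`.
  let B : ℂ → Matrix κ κ ℂ := fun z => L * A z
  have hB : ∀ i j, Differentiable ℂ fun z => B z i j := by
    intro i j
    simp only [B, Matrix.mul_apply]
    exact Differentiable.fun_sum fun k _ => (hA k j).const_mul _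
  have hdet : Differentiable ℂ fun z => (B z).det := by
    simp only [Matrix.det_apply]
    refine Differentiable.fun_sum fun σ _ => Differentiable.const_smul ?_ _
    exact Differentiable.fun_finsetProd fun i _ => hB _ _
  have hdetlim : Tendsto (fun t : ℝ => (B (t * d)).det) atTop (𝓝 1) := by
    have h1 : Tendsto (fun t : ℝ => B (t * d)) atTop (𝓝 (L * A')) := by
      refine tendsto_pi_nhds.2 fun i => tendsto_pi_nhds.2 fun j => ?_
      simp only [B, Matrix.mul_apply]
      exact tendsto_finsetSum _ fun k _ => (hlim k j).const_mul _
    have h2 : Continuous fun M : Matrix κ κ ℂ => M.det := continuous_id.matrix_det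
    have h3 := (h2.tendsto (L * A')).comp h1
    rwa [hL, Matrix.det_one] at h3
  have han : AnalyticOnNhd ℂ (fun z => (B z).det) Set.univ :=
    hdet.differentiableOn.analyticOnNhd isOpen_univ
  have hne : ∀ᶠ z in 𝓝[≠] (x : ℂ), (B z).det ≠ 0 := by
    by_contra h
    have h' : ∃ᶠ z in 𝓝[≠] (x : ℂ), (B z).det = (fun _ => (0 : ℂ)) z := by
      rw [Filter.not_eventually] at h
      exact h.mono fun z hz => not_not.1 hz
    have h0 := han.eq_of_frequently_eq (fun z _ => analyticAt_const) h'
    have h1 : Tendsto (fun t : ℝ => (B (t * d)).det) atTop (𝓝 0) := by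
      exact tendsto_const_nhds.congr fun t => (congrFun h0 _).symm
    exact one_ne_zero (tendsto_nhds_unique hdetlim h1)
  have hcast : Tendsto (fun y : ℝ => (y : ℂ)) (𝓝[≠] x) (𝓝[≠] (x : ℂ)) := by
    refine tendsto_nhdsWithin_of_tendsto_nhds_of_eventually_within _
      (Complex.continuous_ofReal.continuousAt.tendsto.mono_left nhdsWithin_le_nhds) ?_
    filter_upwards [self_mem_nhdsWithin] with y hy
    simpa using hy
  filter_upwards [hcast.eventually hne] with y hy
  let P : ℝ → Matrix κ ι ℂ := fun y' => (B y')⁻¹ * L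
  have hBc : Continuous B :=
    continuous_pi fun i => continuous_pi fun j => (hB i j).continuous
  have hPc : ∀ i j, ContinuousAt (fun y' : ℝ => ‖P y' i j‖) y := by
    intro i j
    have h1 : ContinuousAt (fun y' : ℝ => (B y')⁻¹) y := by
      have h3 : Continuous fun y' : ℝ => B y' := hBc.comp Complex.continuous_ofReal
      simp only [Matrix.inv_def, Ring.inverse_eq_inv']
      exact (h3.matrix_det.continuousAt.inv₀ hy).smul h3.matrix_adjugate.continuousAt
    have h2 : ContinuousAt (fun y' : ℝ => P y') y := by
      have h4 : Continuous fun M : Matrix κ κ ℂ => M * L := continuous_id.matrix_mul continuous_const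
      exact ContinuousAt.comp (g := fun M : Matrix κ κ ℂ => M * L) h4.continuousAt h1
    have h5 : Continuous fun M : Matrix κ ι ℂ => ‖M i j‖ := by fun_prop
    exact ContinuousAt.comp (g := fun M : Matrix κ ι ℂ => ‖M i j‖) h5.continuousAt h2
  refine ⟨∑ j, ∑ i, (‖P y j i‖ + 1), by positivity, ?_⟩
  have hbd : ∀ᶠ y' : ℝ in 𝓝 y, ∀ j i, ‖P y' j i‖ < ‖P y j i‖ + 1 := by
    refine eventually_all.2 fun j => eventually_all.2 fun i => ?_
    exact (hPc j i).eventually_lt_const (lt_add_one _)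
  have hdet' : ∀ᶠ y' : ℝ in 𝓝 y, (B y').det ≠ 0 := by
    have : ContinuousAt (fun y' : ℝ => (B y').det) y :=
      (hdet.continuous.comp Complex.continuous_ofReal).continuousAt
    exact this.eventually_ne hy
  filter_upwards [hbd, hdet'] with y' h1 h2 v C hC hv j
  have h3 : v = (P y').mulVec ((A y').mulVec v) := by
    rw [Matrix.mulVec_mulVec]
    have : P y' * A y' = 1 := by
      simp only [P]
      rw [Matrix.mul_assoc]
      exact Matrix.nonsing_inv_mul _ (isUnit_iff_ne_zero.2 h2)
    rw [this, Matrix.one_mulVec]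
  rw [h3]
  calc ‖(P y').mulVec ((A y').mulVec v) j‖ ≤ ∑ i, ‖P y' j i * (A y').mulVec v i‖ := by
        simp only [Matrix.mulVec, dotProduct]
        exact norm_sum_le _ _
    _ ≤ ∑ i, (‖P y j i‖ + 1) * C := by
        refine Finset.sum_le_sum fun i _ => ?_
        rw [norm_mul]
        exact mul_le_mul (h1 j i).le (hv i) (norm_nonneg _) (by positivity)
    _ = (∑ i, (‖P y j i‖ + 1)) * C := by rw [Finset.sum_mul]
    _ ≤ _ := by
        refine mul_le_mul_of_nonneg_right ?_ hC
        exact Finset.single_le_sum (f := fun j => ∑ i, (‖P y j i‖ + 1))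
          (fun j _ => Finset.sum_nonneg fun i _ => by positivity) (Finset.mem_univ j)

/-- The bases `e^{2πwₖ}` of the exponential sums sampled at integers. -/
noncomputable def expBases {N : ℕ} (w : Fin N → ℂ) : Finset ℂ :=
  Finset.univ.image fun k => Complex.exp (2 * (Real.pi : ℂ) * w k)

/-- Finitely many samples determine the state, uniformly for initial phases in a
suitable interval. -/
theorem exists_window_bound {N : ℕ} (a w : Fin N → ℂ) (hm : ∃ z, expSum a w z ≠ 0) {β : ℝ}
    (hβ : Irrational β) (hβ1 : 1 < β) :
    ∃ (J : ℕ) (c d K : ℝ), 0 < c ∧ c < d ∧ d < 1 ∧ 0 ≤ K ∧ ∀ θ ∈ Set.Ioo c d, ∀ S : ℂ → ℂ,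
      ∀ u : ℕ → ℂ, ∀ C : ℝ, 0 ≤ C → (∀ j ≤ J, ‖∑ l ∈ expBases w, l ^ j * S l +
        ∑ i ∈ Finset.range (J + 1) with (((i : ℕ) : ℝ) + 1) * β < θ + (j : ℕ),
          expSum a w (θ + (j : ℕ) - (((i : ℕ) : ℂ) + 1) * β) * u i‖ ≤ C) →
      ∀ l ∈ expBases w, ‖S l‖ ≤ K * C := by
  classical
  obtain ⟨ω, ⟨k₁, hk₁⟩, b, hb, d, hdom⟩ := exists_dominant_exponent a w hm
  have h0 : ∀ l ∈ expBases w, l ≠ 0 := by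
    intro l hl
    obtain ⟨k, -, rfl⟩ := Finset.mem_image.1 hl
    exact Complex.exp_ne_zero _
  set l₁ := Complex.exp (2 * (Real.pi : ℂ) * ω) with hl₁def
  have hl₁ : l₁ ∈ expBases w := Finset.mem_image.2 ⟨k₁, Finset.mem_univ _, by rw [hk₁]⟩
  -- Avoiding the countable set of values `(i + 1)β - j` makes the pattern of entered inputs locally
  -- constant near `θ₀`.
  obtain ⟨θ₀, hθ₀, hθlo, hθhi⟩ : ∃ θ₀ : ℝ, (∀ i j : ℕ, ((i : ℝ) + 1) * β ≠ θ₀ + j) ∧ 0 < θ₀ ∧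
      θ₀ < min 1 (β - 1) := by
    have hcount : (Set.range fun p : ℕ × ℕ => ((p.1 : ℝ) + 1) * β - p.2).Countable :=
      Set.countable_range _
    obtain ⟨θ₀, h1, h2⟩ := (hcount.dense_compl ℝ).exists_mem_open isOpen_Ioo
      (Set.nonempty_Ioo.2 (lt_min one_pos (sub_pos.2 hβ1)))
    refine ⟨θ₀, fun i j hij => h1 ⟨(i, j), ?_⟩, h2.1, h2.2⟩
    simp only [hij]
    ring
  have hθ1 := lt_of_lt_of_le hθhi (min_le_left _ _)
  have hθ2 := lt_of_lt_of_le hθhi (min_le_right _ _)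
  obtain ⟨J, hJ⟩ := limit_system_unique (expBases w) h0 hl₁ hβ hθlo hθ2 hθ1
  let X : Finset ℕ := (Finset.range (J + 1)).filter fun i : ℕ => ((i : ℝ) + 1) * β < θ₀ + J
  -- The phase becomes complex only inside the exponential sums. The comparisons stay frozen at
  -- `θ₀`, so the entries are entire. The factor `e^{-2πzω}` gives the input columns a limit along
  -- the ray, and it is compensated by rescaling the unknowns `u i`.
  let A : ℂ → Matrix (Fin (J + 1)) (expBases w ⊕ X) ℂ := fun z j c =>
    c.elim (fun l : expBases w => (l : ℂ) ^ (j : ℕ)) fun i : X =>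
      if (((i : ℕ) : ℝ) + 1) * β < θ₀ + (j : ℕ) then
        Complex.exp (-(2 * (Real.pi : ℂ) * z * ω)) *
          expSum a w (z + ((j : ℕ) - (((i : ℕ) : ℂ) + 1) * β)) else 0
  let A' : Matrix (Fin (J + 1)) (expBases w ⊕ X) ℂ := fun j c =>
    c.elim (fun l : expBases w => (l : ℂ) ^ (j : ℕ)) fun i : X =>
      if (((i : ℕ) : ℝ) + 1) * β < θ₀ + (j : ℕ) then
        b * Complex.exp (2 * (Real.pi : ℂ) * ((j : ℕ) - (((i : ℕ) : ℂ) + 1) * β) * ω) else 0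
  have hA : ∀ j c, Differentiable ℂ fun z => A z j c := by
    rintro j (l | i)
    · simp only [A, Sum.elim_inl]
      fun_prop
    · simp only [A, Sum.elim_inr]
      split_ifs
      · have := differentiable_expSum a w
        fun_prop
      · fun_prop
  have hlim : ∀ j c, Tendsto (fun t : ℝ => A (t * d) j c) atTop (𝓝 (A' j c)) := by
    rintro j (l | i)
    · simp only [A, A', Sum.elim_inl]
      exact tendsto_const_nhds
    · simp only [A, A', Sum.elim_inr]
      split_ifs
      · exact hdom _
      · exact tendsto_const_nhds
  have hXsum : ∀ (θ : ℝ), (∀ i ∈ Finset.range (J + 1), ∀ j ∈ Finset.range (J + 1),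
      (((i : ℕ) : ℝ) + 1) * β < θ + (j : ℕ) ↔ (((i : ℕ) : ℝ) + 1) * β < θ₀ + (j : ℕ)) →
      ∀ j : Fin (J + 1), ∀ f : ℕ → ℂ,
      ∑ i ∈ Finset.range (J + 1) with (((i : ℕ) : ℝ) + 1) * β < θ + (j : ℕ), f i =
        ∑ i : X, if (((i : ℕ) : ℝ) + 1) * β < θ₀ + (j : ℕ) then f i else 0 := by
    intro θ hθ j f
    rw [Finset.sum_coe_sort X fun i : ℕ =>
      if ((i : ℝ) + 1) * β < θ₀ + (j : ℕ) then f i else 0, ← Finset.sum_filter]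
    refine Finset.sum_congr ?_ fun _ _ => rfl
    ext i
    simp only [X, Finset.mem_filter]
    constructor
    · rintro ⟨h1, h2⟩
      rw [hθ i h1 j (Finset.mem_range.2 j.2)] at h2
      refine ⟨⟨h1, h2.trans_le ?_⟩, h2⟩
      have : (j : ℕ) ≤ J := Nat.lt_succ_iff.1 j.2
      gcongr
    · rintro ⟨⟨h1, -⟩, h2⟩
      exact ⟨h1, (hθ i h1 j (Finset.mem_range.2 j.2)).2 h2⟩
  have hinj : ∀ v, A'.mulVec v = 0 → v = 0 := by
    intro v hv
    let S : ℂ → ℂ := fun l => if h : l ∈ expBases w then v (Sum.inl ⟨l, h⟩) else 0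
    -- Absorbing `b` and the entry point `(i + 1)β` into the unknown leaves `l₁ ^ j` as its
    -- coefficient, the form treated by `limit_system_unique`.
    let u : ℕ → ℂ := fun i => if h : i ∈ X then
      b * Complex.exp (-(2 * (Real.pi : ℂ) * ((i : ℂ) + 1) * β * ω)) * v (Sum.inr ⟨i, h⟩) else 0
    obtain ⟨hS, hu⟩ := hJ S u (by
      intro j hj
      have e := congrFun hv ⟨j, Nat.lt_succ_of_le hj⟩
      rw [Matrix.mulVec, dotProduct, Fintype.sum_sum_type] at e
      rw [hXsum θ₀ (fun _ _ _ _ => Iff.rfl) ⟨j, Nat.lt_succ_of_le hj⟩, ← Finset.sum_coe_sort]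
      rw [Pi.zero_apply] at e
      refine Eq.trans ?_ e
      congr 1
      · refine Finset.sum_congr rfl fun l _ => ?_
        simp [A', S]
      · refine Finset.sum_congr rfl fun i _ => ?_
        simp only [A', u, Sum.elim_inr]
        split_ifs with h1 h2
        · rw [hl₁def, ← Complex.exp_nat_mul]
          rw [show (2 * (Real.pi : ℂ) * ((j : ℂ) - (((i : ℕ) : ℂ) + 1) * β) * ω) =
            j * (2 * (Real.pi : ℂ) * ω) + -(2 * (Real.pi : ℂ) * (((i : ℕ) : ℂ) + 1) * β * ω) by ring,
            Complex.exp_add]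
          ring
        · exact absurd i.2 h2
        · simp)
    ext (l | i)
    · have := hS l l.2
      simpa [S] using this
    · obtain ⟨h1, h2⟩ := Finset.mem_filter.1 i.2
      have := hu i h1 h2
      simpa [u, hb] using this
  have hev : ∀ᶠ θ : ℝ in 𝓝 θ₀, (∀ i ∈ Finset.range (J + 1), ∀ j ∈ Finset.range (J + 1),
      (((i : ℕ) : ℝ) + 1) * β < θ + (j : ℕ) ↔ (((i : ℕ) : ℝ) + 1) * β < θ₀ + (j : ℕ)) := by
    refine (eventually_all_finset _).2 fun i _ => (eventually_all_finset _).2 fun j _ => ?_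
    have hcont : ContinuousAt (fun θ : ℝ => θ + (j : ℝ)) θ₀ := by fun_prop
    rcases lt_or_gt_of_ne (hθ₀ i j) with h | h
    · filter_upwards [hcont.eventually_const_lt h] with θ hθ
      exact iff_of_true hθ h
    · filter_upwards [hcont.eventually_lt_const h] with θ hθ
      exact iff_of_false hθ.not_gt h.not_gt
  have hIoo : ∀ᶠ θ : ℝ in 𝓝 θ₀, θ ∈ Set.Ioo (0 : ℝ) 1 := Ioo_mem_nhds hθlo hθ1
  obtain ⟨θ₁, ⟨K, hK, hθK⟩, hθ₁, hθ₁'⟩ :=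
    ((eventually_matrix_bound A hA A' d hlim hinj θ₀).and
      ((hev.eventually_nhds.and hIoo.eventually_nhds).filter_mono nhdsWithin_le_nhds)).exists
  obtain ⟨c, d', hcd, hsub⟩ := mem_nhds_iff_exists_Ioo_subset.1 (hθK.and (hθ₁.and hθ₁'))
  have hcd' : c < d' := hcd.1.trans hcd.2
  -- The new endpoints are themselves good phases, hence they lie in `(0, 1)`.
  obtain ⟨c', hc1, hc2⟩ := exists_between hcd'
  obtain ⟨d'', hd1, hd2⟩ := exists_between hc2
  refine ⟨J, c', d'', K, (hsub ⟨hc1, hc2⟩).2.2.1, hd1, (hsub ⟨hc1.trans hd1, hd2⟩).2.2.2, hK, ?_⟩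
  intro θ hθ S u C hC hyp
  obtain ⟨hbound, hcomb, -⟩ := hsub ⟨hc1.trans hθ.1, hθ.2.trans hd2⟩
  let v : expBases w ⊕ X → ℂ := Sum.elim (fun l : expBases w => S l) fun i : X =>
    Complex.exp (2 * (Real.pi : ℂ) * θ * ω) * u i
  have hv := hbound v C hC (by
    intro j
    have e := hyp j (Nat.lt_succ_iff.1 j.2)
    rw [hXsum θ hcomb j, ← Finset.sum_coe_sort] at e
    rw [Matrix.mulVec, dotProduct, Fintype.sum_sum_type]
    refine le_of_eq_of_le (congrArg norm (congrArg₂ (· + ·) rfl ?_)) e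
    refine Finset.sum_congr rfl fun i _ => ?_
    simp only [A, v, Sum.elim_inr]
    split_ifs
    · have h1 : Complex.exp (-(2 * (Real.pi : ℂ) * θ * ω)) *
          Complex.exp (2 * (Real.pi : ℂ) * θ * ω) = 1 := by
        rw [← Complex.exp_add, neg_add_cancel, Complex.exp_zero]
      rw [← add_sub_assoc]
      linear_combination (expSum a w (θ + (j : ℕ) - (((i : ℕ) : ℂ) + 1) * β) * u i) * h1
    · simp)
  intro l hl
  simpa [v] using hv (Sum.inl ⟨l, hl⟩)

/-! ### Linear systems: recovering the inputs from the outputs -/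

/-- The output at distance `τ` of the linear system with state `x`. -/
noncomputable def stateOutput {N : ℕ} (a w : Fin N → ℂ) (x : Fin N → ℂ) (τ : ℝ) : ℂ :=
  ∑ k, a k * Complex.exp (2 * (Real.pi : ℂ) * τ * w k) * x k

/-- Unroll the recurrence. An integer time `j` acts on mode `k` through `(e^{2πw_k})^j`, so modes
with equal bases merge into one unknown. Input `i` enters at `(i + 1)β` and is then weighted by the
exponential sum at the distance elapsed. -/
theorem stateOutput_eq {N : ℕ} (a w : Fin N → ℂ) {β : ℝ} {x : ℕ → Fin N → ℂ} {u : ℕ → ℂ}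
    (hx : ∀ n k, x (n + 1) k = Complex.exp (2 * (Real.pi : ℂ) * β * w k) * x n k + u n)
    (θ : ℝ) (n j : ℕ) :
    stateOutput a w (x n) (θ + j - n * β) =
      ∑ l ∈ expBases w, l ^ j * (∑ k with Complex.exp (2 * (Real.pi : ℂ) * w k) = l,
        a k * Complex.exp (2 * (Real.pi : ℂ) * θ * w k) * x 0 k) +
      ∑ i ∈ Finset.range n, expSum a w (θ + j - ((i : ℂ) + 1) * β) * u i := by
  have hunroll : ∀ n k, x n k = Complex.exp (2 * (Real.pi : ℂ) * (n * β) * w k) * x 0 k +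
      ∑ i ∈ Finset.range n, Complex.exp (2 * (Real.pi : ℂ) * (n * β - (i + 1) * β) * w k) * u i := by
    intro n k
    induction n with
    | zero => simp
    | succ n ih =>
      rw [hx, ih, Finset.sum_range_succ, mul_add, ← mul_assoc, ← Complex.exp_add, Finset.mul_sum,
        add_assoc]
      congr 1
      · congr 2
        push_cast
        ring
      · congr 1
        · refine Finset.sum_congr rfl fun i _ => ?_
          rw [← mul_assoc, ← Complex.exp_add]
          congr 2
          push_cast
          ring
        · push_cast
          rw [sub_self]
          simp
  have h1 : ∑ l ∈ expBases w, l ^ j * (∑ k with Complex.exp (2 * (Real.pi : ℂ) * w k) = l,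
        a k * Complex.exp (2 * (Real.pi : ℂ) * θ * w k) * x 0 k) =
      ∑ k, a k * Complex.exp (2 * (Real.pi : ℂ) * (θ + j) * w k) * x 0 k := by
    rw [← Finset.sum_fiberwise_of_maps_to (t := expBases w)
      (g := fun k => Complex.exp (2 * (Real.pi : ℂ) * w k))
      (fun k _ => Finset.mem_image_of_mem _ (Finset.mem_univ k))]
    refine Finset.sum_congr rfl fun l _ => ?_
    rw [Finset.mul_sum]
    refine Finset.sum_congr rfl fun k hk => ?_
    rw [← (Finset.mem_filter.1 hk).2, ← Complex.exp_nat_mul,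
      show 2 * (Real.pi : ℂ) * (θ + j) * w k =
        j * (2 * (Real.pi : ℂ) * w k) + 2 * (Real.pi : ℂ) * θ * w k by ring, Complex.exp_add]
    ring
  have h2 : ∑ i ∈ Finset.range n, expSum a w (θ + j - ((i : ℂ) + 1) * β) * u i =
      ∑ k, ∑ i ∈ Finset.range n,
        a k * Complex.exp (2 * (Real.pi : ℂ) * (θ + j - ((i : ℂ) + 1) * β) * w k) * u i := by
    rw [Finset.sum_comm]
    exact Finset.sum_congr rfl fun i _ => by rw [expSum, Finset.sum_mul]
  rw [h1, h2, ← Finset.sum_add_distrib, stateOutput]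
  refine Finset.sum_congr rfl fun k _ => ?_
  rw [hunroll n k, mul_add, Finset.mul_sum]
  congr 1
  · rw [← mul_assoc, mul_assoc (a k), ← Complex.exp_add]
    congr 3
    push_cast
    ring
  · refine Finset.sum_congr rfl fun i _ => ?_
    rw [← mul_assoc, mul_assoc (a k), ← Complex.exp_add]
    congr 3
    push_cast
    ring

theorem exists_lattice_gap {β y : ℝ} (hβ : 0 < β) (hy : 0 < y) :
    ∃ n : ℕ, 0 < y - n * β ∧ y - n * β ≤ β := by
  have h1 : 0 < ⌈y / β⌉₊ := Nat.ceil_pos.2 (div_pos hy hβ)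
  refine ⟨⌈y / β⌉₊ - 1, ?_, ?_⟩
  · have h2 := Nat.ceil_lt_add_one (div_pos hy hβ).le
    rw [Nat.cast_sub h1, Nat.cast_one]
    have h3 : ((⌈y / β⌉₊ : ℝ) - 1) < y / β := by linarith
    rw [lt_div_iff₀ hβ] at h3
    linarith
  · have h2 := Nat.le_ceil (y / β)
    rw [div_le_iff₀ hβ] at h2
    rw [Nat.cast_sub h1, Nat.cast_one]
    linarith

/-- For initial phases in a suitable interval, the outputs of the system in finitely many gaps
control its inputs. -/
theorem exists_input_bound {N : ℕ} (a w : Fin N → ℂ)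
    (hm : ∀ ξ : ℝ, 0 < ξ → expSum a w ξ ≠ 0) {β : ℝ} (hβ : Irrational β) (hβ1 : 1 < β) :
    ∃ (J : ℕ) (c d : ℝ), c < d ∧ ∀ P ≥ J, ∃ K : ℝ, 0 ≤ K ∧ ∀ θ ∈ Set.Ioo c d,
      ∀ x : ℕ → Fin N → ℂ, ∀ u : ℕ → ℂ, ∀ C : ℝ, 0 ≤ C →
      (∀ n k, x (n + 1) k = Complex.exp (2 * (Real.pi : ℂ) * β * w k) * x n k + u n) →
      (∀ n ≤ P, ∀ j : ℕ, 0 < θ + j - n * β → θ + j - n * β ≤ β →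
        ‖stateOutput a w (x n) (θ + j - n * β)‖ ≤ C) →
      ∀ i < P, ‖u i‖ ≤ K * C := by
  classical
  obtain ⟨J, c, d, K₀, hc, hcd, hd, hK₀, hwin⟩ :=
    exists_window_bound a w ⟨1, by simpa using hm 1 one_pos⟩ hβ hβ1
  have hβ0 : 0 < β := by linarith
  have hcont : Continuous fun y : ℝ => ‖expSum a w y‖ :=
    ((differentiable_expSum a w).continuous.comp Complex.continuous_ofReal).norm
  -- Since `β > 1`, this is a compact part of the half-line on which the exponential sum does not
  -- vanish.
  obtain ⟨y₀, hy₀, hmin⟩ := (isCompact_Icc (a := β - 1) (b := β)).exists_isMinOn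
    (Set.nonempty_Icc.2 (by linarith)) hcont.continuousOn
  set δ := ‖expSum a w y₀‖ with hδ
  have hδ0 : 0 < δ := norm_pos_iff.2 (hm y₀ (by linarith [hy₀.1]))
  refine ⟨J, c, d, hcd, fun P hP => ?_⟩
  suffices H : ∀ m ≤ P, ∃ K : ℝ, 0 ≤ K ∧ ∀ θ ∈ Set.Ioo c d,
      ∀ x : ℕ → Fin N → ℂ, ∀ u : ℕ → ℂ, ∀ C : ℝ, 0 ≤ C →
      (∀ n k, x (n + 1) k = Complex.exp (2 * (Real.pi : ℂ) * β * w k) * x n k + u n) →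
      (∀ n ≤ P, ∀ j : ℕ, 0 < θ + j - n * β → θ + j - n * β ≤ β →
        ‖stateOutput a w (x n) (θ + j - n * β)‖ ≤ C) →
      ∀ i < m, ‖u i‖ ≤ K * C from H P le_rfl
  intro m
  induction m with
  | zero => exact fun _ => ⟨0, le_rfl, fun θ _ x u C _ _ _ i hi => absurd hi (Nat.not_lt_zero i)⟩
  | succ m ih =>
    intro hmP
    obtain ⟨K, hK, hKb⟩ := ih (by omega)
    obtain ⟨B, hB⟩ := (isCompact_Icc (a := (0 : ℝ)) (b := (m + 2) * β)).exists_bound_of_continuousOn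
      hcont.continuousOn
    set Jm := ⌈((m : ℝ) + 2) * β⌉₊
    set Q := ∑ l ∈ expBases w, (1 + ‖l‖) ^ Jm
    have hQ : 0 ≤ Q := Finset.sum_nonneg fun l _ => by positivity
    have hB0 : 0 ≤ |B| := abs_nonneg B
    set K' := δ⁻¹ * (1 + Q * K₀ + m * (|B| * K)) with hK'
    have hK'0 : 0 ≤ K' := by positivity
    refine ⟨K + K', by positivity, ?_⟩
    intro θ hθ x u C hC hx hout i hi
    have hθ0 : 0 < θ := hc.trans hθ.1
    have hθ1 : θ < 1 := hθ.2.trans hd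
    set S : ℂ → ℂ := fun l => ∑ k with Complex.exp (2 * (Real.pi : ℂ) * w k) = l,
        a k * Complex.exp (2 * (Real.pi : ℂ) * θ * w k) * x 0 k with hSdef
    have hS : ∀ l ∈ expBases w, ‖S l‖ ≤ K₀ * C := by
      refine hwin θ hθ S u C hC fun j hj => ?_
      -- At time `θ + j` in the gap `(nβ, (n + 1)β]`, the inputs already entered are exactly those
      -- with index below `n`.
      obtain ⟨n, hn1, hn2⟩ := exists_lattice_gap hβ0 (show 0 < θ + j by positivity)
      have hnj : n ≤ j := by
        by_contra h
        have h1 : ((j : ℝ) + 1) ≤ n := by exact_mod_cast (not_le.1 h)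
        nlinarith
      have e := hout n (by omega) j hn1 hn2
      rw [stateOutput_eq a w hx] at e
      have hfilt : (Finset.range (J + 1)).filter (fun i : ℕ => ((i : ℝ) + 1) * β < θ + j) =
          Finset.range n := by
        ext i
        simp only [Finset.mem_filter, Finset.mem_range]
        constructor
        · rintro ⟨-, h⟩
          have h1 : ((i : ℝ) + 1) * β < (n + 1) * β := by linarith
          have h2 : ((i : ℝ) + 1) < n + 1 := lt_of_mul_lt_mul_right h1 hβ0.le
          have h3 : i + 1 < n + 1 := by exact_mod_cast h2
          omega
        · intro h
          have h1 : ((i : ℝ) + 1) ≤ n := by exact_mod_cast h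
          exact ⟨by omega, by nlinarith⟩
      rwa [hfilt]
    rcases Nat.lt_succ_iff_lt_or_eq.1 hi with hi | rfl
    · have := hKb θ hθ x u C hC hx hout i hi
      nlinarith [mul_nonneg hK'0 hC]
    -- The last sample in gap `i + 1` lies at distance in `(β - 1, β]` from the entry of `u i`,
    -- where the coefficient of `u i` is at least `δ` in modulus. The state and the earlier inputs
    -- are already bounded.
    set j := ⌊((i : ℝ) + 2) * β - θ⌋₊ with hj
    have hpos : 0 ≤ ((i : ℝ) + 2) * β - θ := by
      have : (0 : ℝ) ≤ i := by positivity
      nlinarith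
    have hj1 := Nat.floor_le hpos
    have hj2 := Nat.lt_floor_add_one (((i : ℝ) + 2) * β - θ)
    rw [← hj] at hj1 hj2
    have hjJ : j ≤ Jm := by
      have : (j : ℝ) ≤ Jm := by
        have := Nat.le_ceil (((i : ℝ) + 2) * β)
        linarith
      exact_mod_cast this
    have e := hout (i + 1) hmP j (by push_cast; nlinarith) (by push_cast; linarith)
    rw [stateOutput_eq a w hx, Finset.sum_range_succ] at e
    have hlow : δ ≤ ‖expSum a w (θ + j - ((i : ℂ) + 1) * β)‖ := by
      have := hmin (show θ + j - ((i : ℝ) + 1) * β ∈ Set.Icc (β - 1) β by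
        constructor <;> linarith)
      simpa using this
    have hT1 : ‖∑ l ∈ expBases w, l ^ j * S l‖ ≤ Q * (K₀ * C) := by
      refine (norm_sum_le _ _).trans ?_
      rw [Finset.sum_mul]
      refine Finset.sum_le_sum fun l hl => ?_
      rw [norm_mul, norm_pow]
      refine mul_le_mul ?_ (hS l hl) (norm_nonneg _) (by positivity)
      have h1 : (1 : ℝ) ≤ 1 + ‖l‖ := le_add_of_nonneg_right (norm_nonneg _)
      calc ‖l‖ ^ j ≤ (1 + ‖l‖) ^ j := by gcongr; linarith
        _ ≤ (1 + ‖l‖) ^ Jm := pow_le_pow_right₀ h1 hjJ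
    have hT2 : ‖∑ i' ∈ Finset.range i, expSum a w (θ + j - ((i' : ℂ) + 1) * β) * u i'‖ ≤
        i * (|B| * (K * C)) := by
      refine (norm_sum_le_of_le _ (fun i' hi' => ?_)).trans
        (le_of_eq (by rw [Finset.sum_const, Finset.card_range, nsmul_eq_mul]))
      have hi'' := Finset.mem_range.1 hi'
      rw [norm_mul]
      refine mul_le_mul ?_ (hKb θ hθ x u C hC hx hout i' hi'') (norm_nonneg _) hB0
      have h1 : ((i' : ℝ) + 1) ≤ i := by exact_mod_cast hi''
      have h2 : (0 : ℝ) ≤ i' := by positivity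
      have := hB (θ + j - ((i' : ℝ) + 1) * β) ⟨by nlinarith, by nlinarith⟩
      rw [norm_norm] at this
      refine le_trans ?_ (le_abs_self B)
      simpa using this
    have hmain : δ * ‖u i‖ ≤ C + Q * (K₀ * C) + i * (|B| * (K * C)) := by
      calc δ * ‖u i‖ ≤ ‖expSum a w (θ + j - ((i : ℂ) + 1) * β) * u i‖ := by
            rw [norm_mul]
            gcongr
        _ ≤ _ := by
            set T1 := ∑ l ∈ expBases w, l ^ j * S l
            set T2 := ∑ i' ∈ Finset.range i, expSum a w (θ + j - ((i' : ℂ) + 1) * β) * u i'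
            set T3 := expSum a w (θ + j - ((i : ℂ) + 1) * β) * u i
            have h1 : T3 = (T1 + (T2 + T3)) - T1 - T2 := by ring
            rw [h1]
            refine (norm_sub_le _ _).trans ?_
            have := norm_sub_le (T1 + (T2 + T3)) T1
            linarith
    have h3 : ‖u i‖ ≤ K' * C := by
      rw [hK', mul_assoc, ← div_eq_inv_mul, le_div_iff₀ hδ0]
      calc ‖u i‖ * δ = δ * ‖u i‖ := mul_comm _ _
        _ ≤ _ := hmain
        _ = _ := by ring
    nlinarith [mul_nonneg hK hC]

/-- Orbits of an irrational rotation meet every interval within a bounded time. -/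
theorem exists_uniform_return_time {β : ℝ} (hβ : Irrational β) {c d : ℝ} (hcd : c < d) :
    ∃ L : ℕ, ∀ ξ : ℝ, ∃ n : ℕ, 1 ≤ n ∧ n ≤ L ∧ ∃ j : ℤ, ξ + n * β + j ∈ Set.Ioo c d := by
  let U : ℤ → Set ℝ := fun p => ⋃ q : ℤ, (fun x : ℝ => x + p * β + q) ⁻¹' Set.Ioo c d
  have hU : ∀ p, IsOpen (U p) := fun p => isOpen_iUnion fun q =>
    isOpen_Ioo.preimage (by fun_prop)
  have hcov : Set.Icc (0 : ℝ) 1 ⊆ ⋃ p, U p := by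
    intro x _
    obtain ⟨p, q, hpq⟩ := exists_small_int_combination (x := β) (y := 1) (by simpa using hβ)
      ((c + d) / 2 - x) (show 0 < (d - c) / 2 by linarith)
    obtain ⟨h1, h2⟩ := abs_lt.1 hpq
    refine Set.mem_iUnion.2 ⟨p, Set.mem_iUnion.2 ⟨q, ?_, ?_⟩⟩ <;> linarith
  obtain ⟨t, ht⟩ := isCompact_Icc.elim_finite_subcover U hU hcov
  obtain ⟨M, hM⟩ : ∃ M : ℕ, ∀ p ∈ t, p.natAbs ≤ M :=
    ⟨t.sup Int.natAbs, fun p hp => Finset.le_sup (f := Int.natAbs) hp⟩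
  -- The finite subcover gives times in `[-M, M]`. Starting from `ξ + (M + 1)β` turns them into
  -- positive times.
  refine ⟨2 * M + 1, fun ξ => ?_⟩
  have hfr : Int.fract (ξ + (M + 1) * β) ∈ Set.Icc (0 : ℝ) 1 :=
    ⟨Int.fract_nonneg _, (Int.fract_lt_one _).le⟩
  obtain ⟨p, hp⟩ := Set.mem_iUnion.1 (ht hfr)
  obtain ⟨hpt, hp⟩ := Set.mem_iUnion.1 hp
  obtain ⟨q, hq⟩ := Set.mem_iUnion.1 hp
  have hpM := hM p hpt
  have hnn : ((p + M + 1).toNat : ℤ) = p + M + 1 := Int.toNat_of_nonneg (by omega)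
  refine ⟨(p + M + 1).toNat, by omega, by omega, q - ⌊ξ + (M + 1) * β⌋, ?_⟩
  have hnn' : ((p + M + 1).toNat : ℝ) = p + M + 1 := by exact_mod_cast hnn
  have hq' : Int.fract (ξ + (M + 1) * β) + p * β + q ∈ Set.Ioo c d := hq
  convert hq' using 1
  rw [hnn', Int.fract]
  push_cast
  ring

/-- The local estimate behind the lower sampling bound: finitely many outputs of a two-sided system
control the input at a given time. -/
theorem exists_local_bound {N : ℕ} (a w : Fin N → ℂ)
    (hm : ∀ ξ : ℝ, 0 < ξ → expSum a w ξ ≠ 0) {β : ℝ} (hβ : Irrational β) (hβ1 : 1 < β) :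
    ∃ (L : ℕ) (K : ℝ), 0 ≤ K ∧ ∀ ξ : ℝ, ∀ x : ℤ → Fin N → ℂ, ∀ u : ℤ → ℂ, ∀ C : ℝ, 0 ≤ C →
      (∀ n k, x (n + 1) k = Complex.exp (2 * (Real.pi : ℂ) * β * w k) * x n k + u (n + 1)) →
      (∀ n : ℤ, |n| ≤ L → ∀ j : ℤ, 0 < ξ + j - n * β → ξ + j - n * β ≤ β →
        ‖stateOutput a w (x n) (ξ + j - n * β)‖ ≤ C) →
      ‖u 0‖ ≤ K * C := by
  obtain ⟨J, c, d, hcd, hP⟩ := exists_input_bound a w hm hβ hβ1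
  obtain ⟨L, hL⟩ := exists_uniform_return_time hβ hcd
  obtain ⟨K, hK, hKb⟩ := hP (max J L) (le_max_left _ _)
  refine ⟨max J L, K, hK, fun ξ x u C hC hx hout => ?_⟩
  obtain ⟨n, hn1, hnL, j₀, hθ⟩ := hL ξ
  have hnP : n ≤ max J L := hnL.trans (le_max_right _ _)
  -- The one-sided system starts `n` steps before time 0, where the phase is good modulo 1. Its
  -- input number `n - 1` is then `u 0`.
  have h := hKb _ hθ (fun m => x (m - n)) (fun m => u (m - n + 1)) C hC (by
    intro m k
    have := hx (m - n) k
    rw [← this]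
    push_cast
    congr 2
    ring) (by
    intro m hmP j h1 h2
    have e : ξ + n * β + j₀ + j - m * β = ξ + ((j₀ + j : ℤ) : ℝ) - ((m - n : ℤ) : ℝ) * β := by
      push_cast
      ring
    rw [e] at h1 h2 ⊢
    exact hout _ (abs_le.2 ⟨by omega, by omega⟩) _ h1 h2) (n - 1) (by omega)
  have e : ((n - 1 : ℕ) : ℤ) - n + 1 = 0 := by omega
  simpa only [e] using h

/-! ### Fourier analysis: samples as Fourier coefficients of outputs -/

theorem memLp_two_restrict_Ioc {f : ℝ → ℂ} (hf : Continuous f) (a b : ℝ) :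
    MemLp f 2 (volume.restrict (Set.Ioc a b)) := by
  obtain ⟨C, hC⟩ := (isCompact_Icc (a := a) (b := b)).exists_bound_of_continuousOn hf.continuousOn
  exact MemLp.of_bound hf.aestronglyMeasurable C
    ((ae_restrict_mem measurableSet_Ioc).mono fun x hx => hC x (Set.Ioc_subset_Icc_self hx))

/-- Parseval's identity for trigonometric polynomials with frequencies in a translate of `ℤ`. -/
theorem integral_norm_sq_trigPoly (F : Finset ℤ) (c : ℤ → ℂ) (x : ℝ) :
    ∫ y in (0 : ℝ)..1, ‖∑ l ∈ F, c l * Complex.exp (2 * (Real.pi : ℂ) * (Complex.I * (x - l)) * y)‖ ^ 2 =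
      ∑ l ∈ F, ‖c l‖ ^ 2 := by
  classical
  let f : ℝ → ℂ := fun y => ∑ l ∈ F, c l * Complex.exp (2 * (Real.pi : ℂ) * (Complex.I * (-l)) * y)
  have hf : Continuous f := by fun_prop
  have h1 : ∀ y : ℝ,
      ‖∑ l ∈ F, c l * Complex.exp (2 * (Real.pi : ℂ) * (Complex.I * (x - l)) * y)‖ = ‖f y‖ := by
    intro y
    have : ∑ l ∈ F, c l * Complex.exp (2 * (Real.pi : ℂ) * (Complex.I * (x - l)) * y) =
        Complex.exp ((2 * Real.pi * x * y : ℝ) * Complex.I) * f y := by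
      rw [Finset.mul_sum]
      refine Finset.sum_congr rfl fun l _ => ?_
      rw [mul_left_comm (Complex.exp _) (c l), ← Complex.exp_add]
      congr 2
      push_cast
      ring
    rw [this, norm_mul, Complex.norm_exp_ofReal_mul_I, one_mul]
  have hcoeff : ∀ n : ℤ, fourierCoeffOn (zero_lt_one' ℝ) f n = if -n ∈ F then c (-n) else 0 := by
    intro n
    rw [fourierCoeffOn_eq_integral]
    simp only [f, fourier_coe_apply, sub_zero, smul_eq_mul, Finset.mul_sum, div_one, one_smul,
      Complex.ofReal_one]
    rw [intervalIntegral.integral_finsetSum (fun l _ => by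
      apply Continuous.intervalIntegrable; fun_prop)]
    rw [← Finset.sum_ite_eq' F (-n) c]
    refine Finset.sum_congr rfl fun l _ => ?_
    have h2 : ∀ y : ℝ, Complex.exp (2 * Real.pi * Complex.I * ((-n : ℤ) : ℂ) * y) *
        (c l * Complex.exp (2 * (Real.pi : ℂ) * (Complex.I * (-l)) * y)) =
        c l * Complex.exp ((2 * Real.pi * Complex.I * ((-n - l : ℤ) : ℂ)) * y) := by
      intro y
      rw [mul_left_comm, ← Complex.exp_add]
      congr 2
      push_cast
      ring
    simp only [h2]
    rw [intervalIntegral.integral_const_mul]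
    by_cases h3 : l = -n
    · simp [h3]
    · rw [if_neg h3, integral_exp_mul_complex]
      · have h4 : Complex.exp (2 * Real.pi * Complex.I * ((-n - l : ℤ) : ℂ) * ((1 : ℝ) : ℂ)) = 1 := by
          rw [Complex.ofReal_one, mul_one, mul_comm]
          exact Complex.exp_int_mul_two_pi_mul_I _
        rw [h4]
        simp
      · have : ((-n - l : ℤ) : ℂ) ≠ 0 := by
          rw [Int.cast_ne_zero]
          omega
        exact mul_ne_zero Complex.two_pi_I_ne_zero this
  have hP := tsum_sq_fourierCoeffOn (zero_lt_one' ℝ) (memLp_two_restrict_Ioc hf 0 1)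
  simp only [hcoeff] at hP
  simp only [h1]
  rw [sub_zero, inv_one, one_smul] at hP
  rw [← hP]
  rw [← (Equiv.neg ℤ).tsum_eq]
  simp only [Equiv.neg_apply, neg_neg]
  rw [tsum_eq_sum (s := F) (fun l hl => by simp [hl])]
  exact Finset.sum_congr rfl fun l hl => by simp [hl]

/-- The states of the linear system driven by a trigonometric polynomial. -/
noncomputable def trigState {N : ℕ} (w : Fin N → ℂ) (β x : ℝ) (F : Finset ℤ) (c : ℤ → ℂ)
    (y : ℝ) (k : Fin N) : ℂ :=
  ∑ l ∈ F, c l * Complex.exp (2 * (Real.pi : ℂ) * (Complex.I * (x - l)) * y) /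
    (1 - Complex.exp (2 * (Real.pi : ℂ) * (w k + Complex.I * (x - l)) * β))

theorem one_sub_exp_ne_zero {z : ℂ} (hz : z.re ≠ 0) (t : ℝ) {β : ℝ} (hβ : β ≠ 0) :
    1 - Complex.exp (2 * (Real.pi : ℂ) * (z + Complex.I * t) * β) ≠ 0 := by
  intro h
  have h1 : ‖Complex.exp (2 * (Real.pi : ℂ) * (z + Complex.I * t) * β)‖ = 1 := by
    rw [← sub_eq_zero.1 h, norm_one]
  rw [Complex.norm_exp, Real.exp_eq_one_iff] at h1
  have h2 : (2 * (Real.pi : ℂ) * (z + Complex.I * t) * β).re = 2 * Real.pi * β * z.re := by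
    rw [show 2 * (Real.pi : ℂ) * (z + Complex.I * t) * β =
      ((2 * Real.pi * β : ℝ) : ℂ) * (z + Complex.I * t) by push_cast; ring, Complex.re_ofReal_mul]
    simp
  rw [h2] at h1
  simp [Real.pi_ne_zero, hβ, hz] at h1

/-- For each frequency, the denominator is what makes the pure exponential a stationary response. It
is nonzero because `Re w_k ≠ 0`. -/
theorem trigState_step {N : ℕ} {w : Fin N → ℂ} (hw : ∀ k, (w k).re ≠ 0) {β : ℝ} (hβ : β ≠ 0)
    (x : ℝ) (F : Finset ℤ) (c : ℤ → ℂ) (y : ℝ) (k : Fin N) :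
    trigState w β x F c y k = Complex.exp (2 * (Real.pi : ℂ) * β * w k) *
      trigState w β x F c (y + β) k +
      ∑ l ∈ F, c l * Complex.exp (2 * (Real.pi : ℂ) * (Complex.I * (x - l)) * y) := by
  rw [trigState, trigState, Finset.mul_sum, ← Finset.sum_add_distrib]
  refine Finset.sum_congr rfl fun l _ => ?_
  have h := one_sub_exp_ne_zero (hw k) (x - l) hβ
  push_cast at h
  have e : Complex.exp (2 * (Real.pi : ℂ) * β * w k) *
      Complex.exp (2 * (Real.pi : ℂ) * (Complex.I * (x - l)) * ((y + β : ℝ) : ℂ)) =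
      Complex.exp (2 * (Real.pi : ℂ) * (Complex.I * (x - l)) * y) *
      Complex.exp (2 * (Real.pi : ℂ) * (w k + Complex.I * (x - l)) * β) := by
    rw [← Complex.exp_add, ← Complex.exp_add]
    congr 1
    push_cast
    ring
  rw [mul_div_assoc', mul_left_comm (Complex.exp _) (c l), e]
  field_simp
  ring

/-- The frequencies lie in `x + ℤ`, so an integer shift multiplies all terms by one unimodular
factor. Values of the output at points differing by integers can thus be read, up to modulus one,
from a single state. -/
theorem trigState_add_int {N : ℕ} (w : Fin N → ℂ) (β x : ℝ) (F : Finset ℤ) (c : ℤ → ℂ) (y : ℝ)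
    (j : ℤ) (k : Fin N) : trigState w β x F c (y + j) k =
      Complex.exp ((2 * Real.pi * x * j : ℝ) * Complex.I) * trigState w β x F c y k := by
  rw [trigState, trigState, Finset.mul_sum]
  refine Finset.sum_congr rfl fun l _ => ?_
  have e : Complex.exp (2 * (Real.pi : ℂ) * (Complex.I * (x - l)) * ((y + j : ℝ) : ℂ)) =
      Complex.exp ((2 * Real.pi * x * j : ℝ) * Complex.I) *
      Complex.exp (2 * (Real.pi : ℂ) * (Complex.I * (x - l)) * y) := by
    rw [← Complex.exp_add, ← mul_one (Complex.exp (_ + _)),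
      ← Complex.exp_int_mul_two_pi_mul_I (-(l * j)), ← Complex.exp_add]
    congr 1
    push_cast
    ring
  rw [e]
  ring

/-- The outputs over one period have the samples as Fourier coefficients. -/
theorem fourierCoeffOn_trigState {N : ℕ} (a : Fin N → ℂ) {w : Fin N → ℂ} (hw : ∀ k, (w k).re ≠ 0)
    {β : ℝ} (hβ : 0 < β) (x : ℝ) (F : Finset ℤ) (c : ℤ → ℂ) (n : ℤ) :
    fourierCoeffOn hβ (fun y => stateOutput a w (trigState w β x F c y) y) n =
      -(2 * Real.pi * Complex.I * β)⁻¹ *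
        ∑ l ∈ F, c l * rationalWindow a w (x - β⁻¹ * n - l) := by
  have hβ' : (β : ℂ) ≠ 0 := by exact_mod_cast hβ.ne'
  rw [fourierCoeffOn_eq_integral]
  simp only [fourier_coe_apply, sub_zero, smul_eq_mul, stateOutput, trigState, Finset.mul_sum]
  rw [intervalIntegral.integral_finsetSum (fun k _ => by
      apply Continuous.intervalIntegrable; fun_prop)]
  have h1 : ∀ k, ∀ l : ℤ, ∫ y in (0 : ℝ)..β,
      Complex.exp (2 * Real.pi * Complex.I * ((-n : ℤ) : ℂ) * y / β) *
        (a k * Complex.exp (2 * (Real.pi : ℂ) * y * w k) *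
          (c l * Complex.exp (2 * (Real.pi : ℂ) * (Complex.I * (x - l)) * y) /
            (1 - Complex.exp (2 * (Real.pi : ℂ) * (w k + Complex.I * (x - l)) * β)))) =
      -(2 * Real.pi * Complex.I)⁻¹ *
        (c l * (a k / (((x - β⁻¹ * n - l : ℝ) : ℂ) - Complex.I * w k))) := by
    intro k l
    have hden := one_sub_exp_ne_zero (hw k) (x - l) hβ.ne'
    push_cast at hden
    set z : ℂ := 2 * Real.pi * Complex.I * (((x - β⁻¹ * n - l : ℝ) : ℂ) - Complex.I * w k) with hz
    have hz0 : ((x - β⁻¹ * n - l : ℝ) : ℂ) - Complex.I * w k ≠ 0 := by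
      intro h
      have := congrArg Complex.im h
      simp at this
      exact hw k this
    have h2 : ∀ y : ℝ, Complex.exp (2 * Real.pi * Complex.I * ((-n : ℤ) : ℂ) * y / β) *
        (a k * Complex.exp (2 * (Real.pi : ℂ) * y * w k) *
          (c l * Complex.exp (2 * (Real.pi : ℂ) * (Complex.I * (x - l)) * y) /
            (1 - Complex.exp (2 * (Real.pi : ℂ) * (w k + Complex.I * (x - l)) * β)))) =
        (a k * c l / (1 - Complex.exp (2 * (Real.pi : ℂ) * (w k + Complex.I * (x - l)) * β))) *
          Complex.exp (z * y) := by
      intro y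
      have h3 : Complex.exp (z * y) = Complex.exp (2 * Real.pi * Complex.I * ((-n : ℤ) : ℂ) * y / β) *
          Complex.exp (2 * (Real.pi : ℂ) * y * w k) *
          Complex.exp (2 * (Real.pi : ℂ) * (Complex.I * (x - l)) * y) := by
        rw [← Complex.exp_add, ← Complex.exp_add]
        congr 1
        rw [hz]
        push_cast
        field_simp
        linear_combination (-(β * w k * y)) * Complex.I_sq
      rw [h3]
      ring
    simp only [h2]
    rw [intervalIntegral.integral_const_mul,
      integral_exp_mul_complex (mul_ne_zero Complex.two_pi_I_ne_zero hz0)]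
    -- At the endpoint `β` the Fourier mode contributes `e^{-2πin} = 1`. The boundary term of the
    -- integral then cancels the denominator of the state.
    have h4 : Complex.exp (z * β) =
        Complex.exp (2 * (Real.pi : ℂ) * (w k + Complex.I * (x - l)) * β) := by
      rw [← mul_one (Complex.exp (2 * _ * _ * _)), ← Complex.exp_int_mul_two_pi_mul_I (-n),
        ← Complex.exp_add]
      congr 1
      rw [hz]
      push_cast
      field_simp
      linear_combination (-w k * β) * Complex.I_sq
    rw [h4, Complex.ofReal_zero, mul_zero, Complex.exp_zero]
    have hpi := Complex.two_pi_I_ne_zero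
    generalize Complex.exp (2 * (Real.pi : ℂ) * (w k + Complex.I * (x - l)) * β) = E at hden ⊢
    generalize ((x - β⁻¹ * n - l : ℝ) : ℂ) - Complex.I * w k = Z at hz0 ⊢
    generalize 2 * (Real.pi : ℂ) * Complex.I = Y at hpi ⊢
    field_simp
    ring
  have h5 : ∀ k, ∫ y in (0 : ℝ)..β, ∑ l ∈ F,
      Complex.exp (2 * Real.pi * Complex.I * ((-n : ℤ) : ℂ) * y / β) *
        (a k * Complex.exp (2 * (Real.pi : ℂ) * y * w k) *
          (c l * Complex.exp (2 * (Real.pi : ℂ) * (Complex.I * (x - l)) * y) /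
            (1 - Complex.exp (2 * (Real.pi : ℂ) * (w k + Complex.I * (x - l)) * β)))) =
      ∑ l ∈ F, -(2 * Real.pi * Complex.I)⁻¹ *
        (c l * (a k / (((x - β⁻¹ * n - l : ℝ) : ℂ) - Complex.I * w k))) := by
    intro k
    rw [intervalIntegral.integral_finsetSum (fun l _ => by
      apply Continuous.intervalIntegrable; fun_prop)]
    exact Finset.sum_congr rfl fun l _ => h1 k l
  simp only [h5]
  rw [Finset.sum_comm, Finset.smul_sum]
  refine Finset.sum_congr rfl fun l _ => ?_
  rw [rationalWindow, ← Finset.mul_sum, ← Finset.mul_sum, Complex.real_smul]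
  push_cast
  field_simp

/-- The lower sampling bound for finite sequences. -/
theorem exists_finite_lower_bound {N : ℕ} (a : Fin N → ℂ) {w : Fin N → ℂ}
    (hw : ∀ k, (w k).re ≠ 0) (hm : ∀ ξ : ℝ, 0 < ξ → expSum a w ξ ≠ 0) {β : ℝ}
    (hβ : Irrational β) (hβ1 : 1 < β) :
    ∃ K : ℝ, 0 ≤ K ∧ ∀ (x : ℝ) (F : Finset ℤ) (c : ℤ → ℂ),
      ∑ l ∈ F, ‖c l‖ ^ 2 ≤
        K * ∑' n : ℤ, ‖∑ l ∈ F, c l * rationalWindow a w (x - β⁻¹ * n - l)‖ ^ 2 := by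
  obtain ⟨L, K, hK, hloc⟩ := exists_local_bound a w hm hβ hβ1
  have hβ0 : 0 < β := by linarith
  set J : ℕ := ⌈((L : ℝ) + 1) * β + 1⌉₊
  let box : Finset (ℤ × ℤ) := Finset.Icc (-L : ℤ) L ×ˢ Finset.Icc (-J : ℤ) J
  -- The first two factors come from integrating the pointwise estimate over the translates in
  -- `box`, the last from Parseval on `(0, β]`. For `ξ ∈ (0, 1]` and `|n| ≤ L`, a point `ξ + j - nβ`
  -- in `(0, β]` forces `|j| ≤ J`.
  refine ⟨K ^ 2 * box.card * (β * (2 * Real.pi * β)⁻¹ ^ 2), by positivity, fun x F c => ?_⟩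
  set φ : ℝ → ℂ := fun y => ∑ l ∈ F, c l * Complex.exp (2 * (Real.pi : ℂ) * (Complex.I * (x - l)) * y)
    with hφ
  set G : ℝ → ℂ := fun y => stateOutput a w (trigState w β x F c y) y with hG
  have hGc : Continuous G := by
    simp only [hG, stateOutput, trigState]
    fun_prop
  have hφc : Continuous φ := by fun_prop
  -- Extension by zero makes every term of the box sum a translate of one integrable function, so
  -- each has the same integral over the line.
  set h : ℝ → ℝ := Set.indicator (Set.Ioc 0 β) fun y => ‖G y‖ ^ 2 with hh
  have hh0 : ∀ y, 0 ≤ h y := fun y => Set.indicator_nonneg (fun _ _ => by positivity) y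
  have hhint : Integrable h := by
    rw [hh, integrable_indicator_iff measurableSet_Ioc]
    exact (Continuous.integrableOn_Icc (by fun_prop)).mono_set Set.Ioc_subset_Icc_self
  have hpoint : ∀ ξ ∈ Set.Ioc (0 : ℝ) 1,
      ‖φ ξ‖ ^ 2 ≤ K ^ 2 * ∑ p ∈ box, h (ξ + (p.2 - p.1 * β)) := by
    intro ξ hξ
    set V := ∑ p ∈ box, h (ξ + (p.2 - p.1 * β)) with hV
    have hV0 : 0 ≤ V := Finset.sum_nonneg fun _ _ => hh0 _
    have := hloc ξ (fun n => trigState w β x F c (ξ - n * β)) (fun n => φ (ξ - n * β))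
      (Real.sqrt V) (Real.sqrt_nonneg _) (by
        intro n k
        rw [trigState_step hw hβ0.ne' x F c]
        congr 3
        push_cast
        ring) (by
        intro n hn j hj1 hj2
        obtain ⟨hn1, hn2⟩ := abs_le.1 hn
        have hn1' : (-L : ℝ) ≤ n := by exact_mod_cast hn1
        have hn2' : (n : ℝ) ≤ L := by exact_mod_cast hn2
        have hJ := Nat.le_ceil (((L : ℝ) + 1) * β + 1)
        have hjJ : (j : ℝ) ≤ J := by nlinarith [hξ.1]
        have hjJ' : (-J : ℝ) ≤ j := by nlinarith [hξ.2]
        have hmem : (n, j) ∈ box := Finset.mem_product.2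
          ⟨Finset.mem_Icc.2 ⟨hn1, hn2⟩, Finset.mem_Icc.2 ⟨by exact_mod_cast hjJ',
            by exact_mod_cast hjJ⟩⟩
        have e : ‖stateOutput a w (trigState w β x F c (ξ - n * β)) (ξ + j - n * β)‖ =
            ‖G (ξ + j - n * β)‖ := by
          have e1 : ξ + j - n * β = (ξ - n * β) + j := by ring
          have e2 : G (ξ + j - n * β) = Complex.exp ((2 * Real.pi * x * j : ℝ) * Complex.I) *
              stateOutput a w (trigState w β x F c (ξ - n * β)) (ξ + j - n * β) := by
            simp only [hG, stateOutput]
            rw [Finset.mul_sum]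
            refine Finset.sum_congr rfl fun k _ => ?_
            rw [e1, trigState_add_int]
            ring
          rw [e2, norm_mul, Complex.norm_exp_ofReal_mul_I, one_mul]
        rw [e]
        refine Real.le_sqrt_of_sq_le ?_
        have e3 : h (ξ + (j - n * β)) = ‖G (ξ + j - n * β)‖ ^ 2 := by
          rw [← add_sub_assoc, hh, Set.indicator_of_mem (show ξ + j - n * β ∈ Set.Ioc 0 β from
            ⟨hj1, hj2⟩)]
        rw [← e3]
        exact Finset.single_le_sum (f := fun p : ℤ × ℤ => h (ξ + (p.2 - p.1 * β)))
          (fun p _ => hh0 _) hmem)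
    simp only [Int.cast_zero, zero_mul, sub_zero] at this
    calc ‖φ ξ‖ ^ 2 ≤ (K * Real.sqrt V) ^ 2 := by gcongr
      _ = K ^ 2 * V := by rw [mul_pow, Real.sq_sqrt hV0]
  have hP := tsum_sq_fourierCoeffOn hβ0 (memLp_two_restrict_Ioc hGc 0 β)
  have hcoef : ∀ n : ℤ, ‖fourierCoeffOn hβ0 G n‖ ^ 2 = (2 * Real.pi * β)⁻¹ ^ 2 *
      ‖∑ l ∈ F, c l * rationalWindow a w (x - β⁻¹ * n - l)‖ ^ 2 := by
    intro n
    rw [fourierCoeffOn_trigState a hw hβ0, norm_mul, mul_pow]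
    simp [abs_of_pos hβ0, abs_of_pos Real.pi_pos]
  simp only [hcoef] at hP
  rw [tsum_mul_left, sub_zero, smul_eq_mul, eq_inv_mul_iff_mul_eq₀ hβ0.ne',
    intervalIntegral.integral_of_le hβ0.le] at hP
  rw [← integral_norm_sq_trigPoly F c x, intervalIntegral.integral_of_le zero_le_one]
  have hint : ∀ p : ℤ × ℤ, Integrable fun ξ : ℝ => h (ξ + (p.2 - p.1 * β)) := fun p =>
    hhint.comp_add_right _
  calc ∫ y in Set.Ioc (0 : ℝ) 1, ‖φ y‖ ^ 2
      ≤ ∫ y in Set.Ioc (0 : ℝ) 1, K ^ 2 * ∑ p ∈ box, h (y + (p.2 - p.1 * β)) := by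
        refine setIntegral_mono_on ?_ ?_ measurableSet_Ioc hpoint
        · exact (Continuous.integrableOn_Icc (by fun_prop)).mono_set Set.Ioc_subset_Icc_self
        · exact ((integrable_finsetSum _ fun p _ => hint p).const_mul _).integrableOn
    _ ≤ ∫ y, K ^ 2 * ∑ p ∈ box, h (y + (p.2 - p.1 * β)) := by
        refine setIntegral_le_integral ((integrable_finsetSum _ fun p _ => hint p).const_mul _) ?_
        exact Eventually.of_forall fun y =>
          mul_nonneg (by positivity) (Finset.sum_nonneg fun _ _ => hh0 _)
    _ = K ^ 2 * box.card * ∫ y, h y := by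
        rw [integral_const_mul, integral_finsetSum _ fun p _ => hint p]
        simp only [integral_add_right_eq_self, Finset.sum_const, nsmul_eq_mul]
        ring
    _ = K ^ 2 * box.card * ∫ y in Set.Ioc 0 β, ‖G y‖ ^ 2 := by
        rw [hh, integral_indicator measurableSet_Ioc]
    _ = _ := by
        rw [← hP]
        ring

/-! ### Upper bounds -/

open scoped ENNReal in
/-- A Schur test for nonnegative matrices. -/
theorem tsum_sq_tsum_mul_le {ι κ : Type*} (A : ι → κ → ℝ≥0∞) (c : κ → ℝ≥0∞) {P Q : ℝ≥0∞}
    (hP : ∀ n, ∑' k, A n k ≤ P) (hQ : ∀ k, ∑' n, A n k ≤ Q) :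
    ∑' n, (∑' k, c k * A n k) ^ 2 ≤ 2 * P * Q * ∑' k, c k ^ 2 := by
  have hcc : ∀ x y : ℝ≥0∞, x * y ≤ x ^ 2 + y ^ 2 := by
    intro x y
    rcases le_total x y with h | h
    · exact (mul_le_mul_left h y).trans (by rw [← sq]; exact le_add_self)
    · exact (mul_le_mul_right h x).trans (by rw [← sq]; exact le_self_add)
  have hrow : ∀ n, (∑' k, c k * A n k) ^ 2 ≤ 2 * P * ∑' k, c k ^ 2 * A n k := by
    intro n
    calc (∑' k, c k * A n k) ^ 2 = ∑' k, ∑' k', (c k * A n k) * (c k' * A n k') := by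
          simp only [ENNReal.tsum_mul_left, ENNReal.tsum_mul_right, sq]
      _ ≤ ∑' k, ∑' k', ((c k ^ 2 * A n k) * A n k' + A n k * (c k' ^ 2 * A n k')) := by
          refine ENNReal.tsum_le_tsum fun k => ENNReal.tsum_le_tsum fun k' => ?_
          calc (c k * A n k) * (c k' * A n k') = (c k * c k') * (A n k * A n k') := by ring
            _ ≤ (c k ^ 2 + c k' ^ 2) * (A n k * A n k') := by gcongr; exact hcc _ _
            _ = _ := by ring
      _ = 2 * ((∑' k, A n k) * ∑' k, c k ^ 2 * A n k) := by
          simp only [ENNReal.tsum_add, ENNReal.tsum_mul_left, ENNReal.tsum_mul_right]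
          ring
      _ ≤ 2 * (P * ∑' k, c k ^ 2 * A n k) := by gcongr; exact hP n
      _ = _ := by ring
  calc ∑' n, (∑' k, c k * A n k) ^ 2 ≤ ∑' n, 2 * P * ∑' k, c k ^ 2 * A n k :=
        ENNReal.tsum_le_tsum hrow
    _ = 2 * P * ∑' k, c k ^ 2 * ∑' n, A n k := by
        rw [ENNReal.tsum_mul_left, ENNReal.tsum_comm]
        simp only [ENNReal.tsum_mul_left]
    _ ≤ 2 * P * ∑' k, c k ^ 2 * Q := by
        gcongr with k
        exact hQ k
    _ = _ := by
        rw [ENNReal.tsum_mul_right]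
        ring

open scoped ENNReal in
-- Split `n` by residues modulo `q = ⌈1/α⌉`. Within a class the points are at least 1 apart, so they
-- have distinct integer parts and the amalgam norm bounds their sum.
theorem MemWienerAmalgam.exists_tsum_enorm_le {g : ℝ → ℂ} (hg : MemWienerAmalgam g) {α : ℝ}
    (hα : 0 < α) : ∃ B : ℝ≥0∞, B ≠ ∞ ∧ ∀ x : ℝ, ∑' n : ℤ, ‖g (x + α * n)‖ₑ ≤ B := by
  obtain ⟨hc, hs⟩ := hg
  set s : ℤ → ℝ := fun k => sSup ((fun x : ℝ => ‖g x‖) '' Set.Icc (k : ℝ) ((k : ℝ) + 1))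
  have hle : ∀ y : ℝ, ‖g y‖ₑ ≤ ENNReal.ofReal (s ⌊y⌋) := by
    intro y
    rw [← ofReal_norm]
    refine ENNReal.ofReal_le_ofReal ?_
    exact le_csSup (isCompact_Icc.image hc.norm).bddAbove
      ⟨y, ⟨Int.floor_le y, (Int.lt_floor_add_one y).le⟩, rfl⟩
  set q := ⌈1 / α⌉₊ with hq
  have hq0 : 0 < q := Nat.ceil_pos.2 (by positivity)
  have hqα : 1 ≤ α * q := by
    have := Nat.le_ceil (1 / α)
    rw [div_le_iff₀ hα] at this
    linarith
  have : NeZero q := ⟨hq0.ne'⟩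
  refine ⟨∑ _r : Fin q, ∑' j, ENNReal.ofReal (s j), ?_, fun x => ?_⟩
  · exact ENNReal.sum_ne_top.2 fun _ _ => hs.tsum_ofReal_ne_top
  rw [← (Int.divModEquiv q).symm.tsum_eq, ENNReal.tsum_prod', ENNReal.tsum_comm, tsum_fintype]
  refine Finset.sum_le_sum fun r _ => ?_
  refine (ENNReal.tsum_le_tsum fun m => hle _).trans ?_
  refine ENNReal.tsum_comp_le_tsum_of_injective
    (f := fun m : ℤ => ⌊x + α * (((Int.divModEquiv q).symm (m, r) : ℤ) : ℝ)⌋) ?_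
    fun j => ENNReal.ofReal (s j)
  have hmono : StrictMono fun m : ℤ => ⌊x + α * (((Int.divModEquiv q).symm (m, r) : ℤ) : ℝ)⌋ := by
    refine strictMono_int_of_lt_succ fun m => ?_
    have h1 : x + α * (((Int.divModEquiv q).symm (m, r) : ℤ) : ℝ) + 1 ≤
        x + α * (((Int.divModEquiv q).symm (m + 1, r) : ℤ) : ℝ) := by
      simp only [Int.divModEquiv_symm_apply]
      push_cast
      nlinarith
    have h2 := Int.floor_le_floor h1
    rw [Int.floor_add_one] at h2
    omega
  exact hmono.injective

theorem summable_sq_of_enorm_le {ι : Type*} {F : ι → ℂ} {C : ℝ} (hC : 0 ≤ C)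
    (h : ∑' n, ‖F n‖ₑ ^ 2 ≤ ENNReal.ofReal C) :
    Summable (fun n => ‖F n‖ ^ 2) ∧ ∑' n, ‖F n‖ ^ 2 ≤ C := by
  have hfin : ∀ s : Finset ι, ∑ n ∈ s, ‖F n‖ ^ 2 ≤ C := by
    intro s
    rw [← ENNReal.ofReal_le_ofReal_iff hC, ENNReal.ofReal_sum_of_nonneg fun _ _ => by positivity]
    refine le_trans ?_ h
    refine le_trans (le_of_eq ?_) (ENNReal.sum_le_tsum s)
    refine Finset.sum_congr rfl fun n _ => ?_
    rw [ENNReal.ofReal_pow (norm_nonneg _), ofReal_norm]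
  exact ⟨summable_of_sum_le (fun _ => by positivity) hfin,
    Real.tsum_le_of_sum_le (fun _ => by positivity) hfin⟩

theorem tsum_enorm_sq {ι : Type*} {c : ι → ℂ} (hc : Summable fun k => ‖c k‖ ^ 2) :
    ∑' k, ‖c k‖ₑ ^ 2 = ENNReal.ofReal (∑' k, ‖c k‖ ^ 2) := by
  rw [ENNReal.ofReal_tsum_of_nonneg (fun _ => by positivity) hc]
  refine tsum_congr fun k => ?_
  rw [ENNReal.ofReal_pow (norm_nonneg _), ofReal_norm]

/-- Samples of a series of integer shifts of an amalgam function are controlled by its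
coefficients. -/
theorem MemWienerAmalgam.exists_upper_bound {g : ℝ → ℂ} (hg : MemWienerAmalgam g) {α : ℝ}
    (hα : 0 < α) : ∃ B : ℝ, 0 < B ∧ ∀ c : ℤ → ℂ, Summable (fun k => ‖c k‖ ^ 2) →
      (∀ t : ℝ, Summable fun k : ℤ => c k * g (t - k)) ∧ ∀ x : ℝ,
      Summable (fun n : ℤ => ‖∑' k : ℤ, c k * g (x + α * n - k)‖ ^ 2) ∧
      ∑' n : ℤ, ‖∑' k : ℤ, c k * g (x + α * n - k)‖ ^ 2 ≤ B * ∑' k, ‖c k‖ ^ 2 := by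
  obtain ⟨Q, hQtop, hQ⟩ := hg.exists_tsum_enorm_le hα
  obtain ⟨P, hPtop, hP⟩ := hg.exists_tsum_enorm_le one_pos
  have hP' : ∀ t : ℝ, ∑' k : ℤ, ‖g (t - k)‖ₑ ≤ P := by
    intro t
    rw [← (Equiv.neg ℤ).tsum_eq]
    refine le_trans (le_of_eq (tsum_congr fun k => ?_)) (hP t)
    congr 2
    simp
  have hQ' : ∀ x : ℝ, ∀ k : ℤ, ∑' n : ℤ, ‖g (x + α * n - k)‖ₑ ≤ Q := by
    intro x k
    refine le_trans (le_of_eq (tsum_congr fun n => ?_)) (hQ (x - k))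
    congr 2
    ring
  have hB : 2 * P * Q ≠ ⊤ := ENNReal.mul_ne_top (ENNReal.mul_ne_top ENNReal.ofNat_ne_top hPtop) hQtop
  refine ⟨(2 * P * Q).toReal + 1, by positivity, fun c hc => ?_⟩
  have hS0 : 0 ≤ ∑' k, ‖c k‖ ^ 2 := tsum_nonneg fun _ => by positivity
  have hC0 : 0 ≤ ((2 * P * Q).toReal + 1) * ∑' k, ‖c k‖ ^ 2 := by positivity
  have hsch : ∀ x : ℝ, ∑' n : ℤ, (∑' k : ℤ, ‖c k‖ₑ * ‖g (x + α * n - k)‖ₑ) ^ 2 ≤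
      ENNReal.ofReal (((2 * P * Q).toReal + 1) * ∑' k, ‖c k‖ ^ 2) := by
    intro x
    refine (tsum_sq_tsum_mul_le (fun n k : ℤ => ‖g (x + α * n - k)‖ₑ) _ (fun n => hP' _)
      (hQ' x)).trans ?_
    rw [tsum_enorm_sq hc, ENNReal.ofReal_mul (by positivity)]
    gcongr
    exact (ENNReal.le_ofReal_iff_toReal_le hB (by positivity)).2 (by linarith)
  refine ⟨fun t => ?_, fun x => summable_sq_of_enorm_le hC0 (le_trans ?_ (hsch x))⟩
  · refine Summable.of_enorm ?_
    -- The term `n = 0` of the Schur estimate at the translate `t` already gives absolute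
    -- convergence there.
    have h1 := (ENNReal.le_tsum 0).trans (hsch t)
    have h2 : (∑' k : ℤ, ‖c k‖ₑ * ‖g (t - k)‖ₑ) ^ 2 ≠ ⊤ := by
      refine ne_top_of_le_ne_top ENNReal.ofReal_ne_top (le_trans (le_of_eq ?_) h1)
      simp
    simp only [enorm_mul]
    intro h3
    exact h2 (by rw [h3]; simp)
  · refine ENNReal.tsum_le_tsum fun n => ?_
    gcongr
    refine enorm_tsum_le_tsum_enorm.trans (le_of_eq ?_)
    simp only [enorm_mul]

/-! ### Lower bounds -/

/-- The lower sampling bound, uniformly in translates of the lattice. -/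
theorem exists_lower_bound {N : ℕ} (a w : Fin N → ℂ) (hw : ∀ k, (w k).re ≠ 0)
    (hW : MemWienerAmalgam (rationalWindow a w)) (hm : ∀ ξ : ℝ, 0 < ξ → mZero a w ξ ≠ 0)
    {α : ℝ} (hα0 : 0 < α) (hα1 : α < 1) (hα : Irrational α) :
    ∃ A : ℝ, 0 < A ∧ ∀ (x : ℝ) (c : ℤ → ℂ), Summable (fun k => ‖c k‖ ^ 2) →
      A * ∑' k, ‖c k‖ ^ 2 ≤
        ∑' n : ℤ, ‖∑' k : ℤ, c k * rationalWindow a w (x + α * n - k)‖ ^ 2 := by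
  classical
  set g := rationalWindow a w
  obtain ⟨B, hB, hup⟩ := hW.exists_upper_bound hα0
  obtain ⟨K, hK, hlow⟩ := exists_finite_lower_bound a hw hm (irrational_inv_iff.2 hα)
    ((one_lt_inv₀ hα0).2 hα1)
  refine ⟨(2 * K + 1)⁻¹, by positivity, fun x c hc => ?_⟩
  set Sf := ∑' n : ℤ, ‖∑' k : ℤ, c k * g (x + α * n - k)‖ ^ 2
  have hSf : 0 ≤ Sf := tsum_nonneg fun _ => by positivity
  -- Apply the finite bound to the truncation of `c` to `F`. The samples of the remainder are
  -- controlled by its own energy, which vanishes as `F` grows.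
  have hbound : ∀ F : Finset ℤ, ∑ l ∈ F, ‖c l‖ ^ 2 ≤
      K * (2 * Sf + 2 * (B * (∑' k, ‖c k‖ ^ 2 - ∑ l ∈ F, ‖c l‖ ^ 2))) := by
    intro F
    let r : ℤ → ℂ := fun k => if k ∈ F then 0 else c k
    have hr : HasSum (fun k => ‖r k‖ ^ 2) (∑' k, ‖c k‖ ^ 2 - ∑ l ∈ F, ‖c l‖ ^ 2) := by
      have h1 : HasSum (fun k => if k ∈ F then ‖c k‖ ^ 2 else 0) (∑ l ∈ F, ‖c l‖ ^ 2) := by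
        have h2 : HasSum (fun k => if k ∈ F then ‖c k‖ ^ 2 else 0)
            (∑ k ∈ F, if k ∈ F then ‖c k‖ ^ 2 else 0) :=
          hasSum_sum_of_ne_finset_zero fun k hk => if_neg hk
        rwa [Finset.sum_congr rfl fun k hk => if_pos hk] at h2
      refine (hc.hasSum.sub h1).congr_fun fun k => ?_
      by_cases hk : k ∈ F <;> simp [r, hk]
    obtain ⟨hrs, hrb⟩ := hup r hr.summable
    obtain ⟨hcs, hcb⟩ := hup c hc
    rw [hr.tsum_eq] at hrb
    have hsplit : ∀ t : ℝ, ∑ l ∈ F, c l * g (t - l) =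
        ∑' k : ℤ, c k * g (t - k) - ∑' k : ℤ, r k * g (t - k) := by
      intro t
      rw [← (hcs t).tsum_sub (hrs t), tsum_eq_sum (s := F) fun k hk => by simp [r, hk]]
      exact Finset.sum_congr rfl fun k hk => by simp [r, hk]
    have h3 := hlow x F c
    rw [← (Equiv.neg ℤ).tsum_eq] at h3
    have h4 : ∀ n : ℤ, x - (α⁻¹)⁻¹ * ((Equiv.neg ℤ n : ℤ) : ℝ) = x + α * n := by
      intro n
      simp
    simp only [h4] at h3
    refine h3.trans (mul_le_mul_of_nonneg_left ?_ hK)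
    obtain ⟨hr1, hr2⟩ := hrb x
    have hle : ∀ n : ℤ, ‖∑ l ∈ F, c l * g (x + α * n - l)‖ ^ 2 ≤
        2 * ‖∑' k : ℤ, c k * g (x + α * n - k)‖ ^ 2 +
          2 * ‖∑' k : ℤ, r k * g (x + α * n - k)‖ ^ 2 := by
      intro n
      rw [hsplit]
      have h5 := norm_sub_le (∑' k : ℤ, c k * g (x + α * n - k)) (∑' k : ℤ, r k * g (x + α * n - k))
      have h6 := pow_le_pow_left₀ (norm_nonneg _) h5 2
      nlinarith [sq_nonneg (‖∑' k : ℤ, c k * g (x + α * n - k)‖ -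
        ‖∑' k : ℤ, r k * g (x + α * n - k)‖)]
    have hsum := ((hcb x).1.mul_left 2).add (hr1.mul_left 2)
    refine ((Summable.of_nonneg_of_le (fun _ => by positivity) hle hsum).tsum_le_tsum hle hsum).trans ?_
    rw [((hcb x).1.mul_left 2).tsum_add (hr1.mul_left 2), tsum_mul_left, tsum_mul_left]
    gcongr
  have hlim : ∑' k, ‖c k‖ ^ 2 ≤ K * (2 * Sf) := by
    have h1 : Tendsto (fun F : Finset ℤ => ∑ l ∈ F, ‖c l‖ ^ 2) atTop (𝓝 (∑' k, ‖c k‖ ^ 2)) :=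
      hc.hasSum
    have h2 : Tendsto (fun F : Finset ℤ =>
        K * (2 * Sf + 2 * (B * (∑' k, ‖c k‖ ^ 2 - ∑ l ∈ F, ‖c l‖ ^ 2)))) atTop
        (𝓝 (K * (2 * Sf + 2 * (B * (∑' k, ‖c k‖ ^ 2 - ∑' k, ‖c k‖ ^ 2))))) :=
      ((((tendsto_const_nhds.sub h1).const_mul B).const_mul 2).const_add _).const_mul K
    have h3 := le_of_tendsto_of_tendsto' h1 h2 hbound
    simpa using h3
  rw [inv_mul_le_iff₀ (by positivity)]
  nlinarith

/-! ### Square integrability -/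

open scoped ENNReal in
theorem lintegral_eq_setLIntegral_tsum {α : ℝ} (hα : 0 < α) {h : ℝ → ℝ≥0∞} (hh : Measurable h) :
    ∫⁻ t, h t = ∫⁻ x in Set.Ioc 0 α, ∑' n : ℤ, h (x + α * n) := by
  have hdisj : Pairwise (Function.onFun Disjoint fun n : ℤ => Set.Ioc (n • α) ((n + 1) • α)) :=
    Set.pairwise_disjoint_Ioc_zsmul α
  rw [← setLIntegral_univ, ← iUnion_Ioc_zsmul hα,
    lintegral_iUnion (fun _ => measurableSet_Ioc) hdisj, lintegral_tsum fun n => by fun_prop]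
  refine tsum_congr fun n => ?_
  rw [← (measurePreserving_add_right volume (α * n)).setLIntegral_comp_preimage measurableSet_Ioc hh]
  congr 2
  rw [Set.preimage_add_const_Ioc]
  congr 1
  · simp [mul_comm]
  · simp only [zsmul_eq_mul]
    push_cast
    ring

/-- Two-sided bounds for all translates of a lattice yield two-sided bounds for the `L²` norm. -/
theorem memLp_two_of_lattice_bounds {f : ℝ → ℂ} (hf : Measurable f) {α C D : ℝ} (hα : 0 < α)
    (hD : 0 ≤ D) (hs : ∀ x : ℝ, Summable fun n : ℤ => ‖f (x + α * n)‖ ^ 2)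
    (hC : ∀ x : ℝ, C ≤ ∑' n : ℤ, ‖f (x + α * n)‖ ^ 2)
    (hD' : ∀ x : ℝ, ∑' n : ℤ, ‖f (x + α * n)‖ ^ 2 ≤ D) :
    MemLp f 2 volume ∧ α * C ≤ ∫ t, ‖f t‖ ^ 2 ∧ ∫ t, ‖f t‖ ^ 2 ≤ α * D := by
  have hfm : Measurable fun t => ENNReal.ofReal (‖f t‖ ^ 2) := by fun_prop
  have hL := lintegral_eq_setLIntegral_tsum hα hfm
  have hL' : ∫⁻ t, ENNReal.ofReal (‖f t‖ ^ 2) =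
      ∫⁻ x in Set.Ioc 0 α, ENNReal.ofReal (∑' n : ℤ, ‖f (x + α * n)‖ ^ 2) := by
    rw [hL]
    refine lintegral_congr fun x => ?_
    rw [ENNReal.ofReal_tsum_of_nonneg (fun _ => by positivity) (hs x)]
  have hupper : ∫⁻ t, ENNReal.ofReal (‖f t‖ ^ 2) ≤ ENNReal.ofReal (α * D) := by
    rw [hL']
    refine (lintegral_mono fun x => ENNReal.ofReal_le_ofReal (hD' x)).trans (le_of_eq ?_)
    rw [setLIntegral_const, Real.volume_Ioc, sub_zero, ← ENNReal.ofReal_mul hD, mul_comm]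
  have hlower : ENNReal.ofReal (α * C) ≤ ∫⁻ t, ENNReal.ofReal (‖f t‖ ^ 2) := by
    rw [hL']
    refine le_trans (le_of_eq ?_) (lintegral_mono fun x => ENNReal.ofReal_le_ofReal (hC x))
    rw [setLIntegral_const, Real.volume_Ioc, sub_zero, ENNReal.ofReal_mul hα.le, mul_comm]
  have hint : ∫ t, ‖f t‖ ^ 2 = (∫⁻ t, ENNReal.ofReal (‖f t‖ ^ 2)).toReal :=
    integral_eq_lintegral_of_nonneg_ae (Eventually.of_forall fun _ => by positivity)
      (by fun_prop)
  refine ⟨?_, ?_, ?_⟩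
  · rw [memLp_two_iff_integrable_sq_norm hf.aestronglyMeasurable]
    refine ⟨by fun_prop, ?_⟩
    rw [hasFiniteIntegral_iff_ofReal (Eventually.of_forall fun _ => by positivity)]
    exact hupper.trans_lt ENNReal.ofReal_lt_top
  · rw [hint]
    exact (ENNReal.ofReal_le_iff_le_toReal (ne_top_of_le_ne_top ENNReal.ofReal_ne_top hupper)).1
      hlower
  · rw [hint]
    exact ENNReal.toReal_le_of_le_ofReal (by positivity) hupper

theorem measurable_shiftSeries {g : ℝ → ℂ} (hg : Continuous g) (c : lp (fun _ : ℤ => ℂ) 2)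
    (hs : ∀ t : ℝ, Summable fun k : ℤ => c k * g (t - k)) : Measurable (shiftSeries g c) := by
  refine measurable_of_tendsto_metrizable' (atTop : Filter (Finset ℤ))
    (f := fun F t => ∑ k ∈ F, c k * g (t - k)) (fun F => ?_)
    (tendsto_pi_nhds.2 fun t => (hs t).hasSum)
  have : Measurable g := hg.measurable
  fun_prop

theorem lp_two_norm_sq (c : lp (fun _ : ℤ => ℂ) 2) :
    HasSum (fun k => ‖c k‖ ^ 2) (‖c‖ ^ 2) := by
  have := lp.hasSum_norm (p := 2) (by norm_num) c
  simpa using this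

theorem isSeparatedSet_lattice {α : ℝ} (hα : 0 < α) :
    IsSeparatedSet (Set.range fun k : ℤ => α * (k : ℝ)) := by
  refine ⟨α / 2, by positivity, ?_⟩
  rintro _ ⟨k, rfl⟩ _ ⟨l, rfl⟩ hne
  have hkl : k - l ≠ 0 := by
    rintro h
    exact hne (by rw [sub_eq_zero.1 h])
  have h1 : (1 : ℝ) ≤ |((k - l : ℤ) : ℝ)| := by
    rw [← Int.cast_abs]
    exact_mod_cast Int.one_le_abs hkl
  have h2 : α * (k : ℝ) - α * l = α * ((k - l : ℤ) : ℝ) := by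
    push_cast
    ring
  simp only [h2, abs_mul, abs_of_pos hα]
  nlinarith

theorem sum_lattice_eq {α : ℝ} (hα : 0 < α) (f : ℝ → ℂ) :
    ((Summable fun l : Set.range fun k : ℤ => α * (k : ℝ) => ‖f l‖ ^ 2) ↔
      Summable fun k : ℤ => ‖f (α * k)‖ ^ 2) ∧
    ∑' l : Set.range fun k : ℤ => α * (k : ℝ), ‖f l‖ ^ 2 = ∑' k : ℤ, ‖f (α * k)‖ ^ 2 := by
  have hinj : Function.Injective fun k : ℤ => α * (k : ℝ) := fun k l hkl =>
    Int.cast_injective (mul_left_cancel₀ hα.ne' hkl)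
  let e := Equiv.ofInjective _ hinj
  let F : (Set.range fun k : ℤ => α * (k : ℝ)) → ℝ := fun l => ‖f l‖ ^ 2
  exact ⟨(e.summable_iff (f := F)).symm, (e.tsum_eq F).symm⟩

/-! ### Assembly of the theorem -/

theorem mainTheorem12 {N : ℕ} (a w : Fin N → ℂ) (hw : ∀ k, (w k).re ≠ 0)
    (hW : MemWienerAmalgam (rationalWindow a w))
    (hm : ∀ ξ : ℝ, 0 < ξ → mZero a w ξ ≠ 0)
    (α : ℝ) (hα0 : 0 < α) (hα1 : α < 1) :
    -- the series defining the elements of the space converge, to functions in `L²(ℝ)`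
    (∀ c : lp (fun _ : ℤ => ℂ) 2,
      (∀ t : ℝ, Summable fun k : ℤ => c k * rationalWindow a w (t - k)) ∧
      MemLp (shiftSeries (rationalWindow a w) c) 2 volume) ∧
    -- the upper bounds, for every `α ∈ (0, 1)`
    (∃ B : ℝ, 0 < B ∧ ∀ c : lp (fun _ : ℤ => ℂ) 2,
      Summable (fun k : ℤ => ‖shiftSeries (rationalWindow a w) c (α * k)‖ ^ 2) ∧
      ∑' k : ℤ, ‖shiftSeries (rationalWindow a w) c (α * k)‖ ^ 2 ≤ B * ‖c‖ ^ 2 ∧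
      ∑' k : ℤ, ‖shiftSeries (rationalWindow a w) c (α * k)‖ ^ 2
        ≤ B * ∫ t, ‖shiftSeries (rationalWindow a w) c t‖ ^ 2) ∧
    -- the sampling property and the two-sided bounds, for irrational `α`
    (Irrational α →
      IsSamplingSet (shiftInvariantSpace (rationalWindow a w))
        (Set.range fun k : ℤ => α * (k : ℝ)) ∧
      ∃ A B : ℝ, 0 < A ∧ 0 < B ∧ ∀ c : lp (fun _ : ℤ => ℂ) 2,
        Summable (fun k : ℤ => ‖shiftSeries (rationalWindow a w) c (α * k)‖ ^ 2) ∧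
        A * ‖c‖ ^ 2 ≤ ∑' k : ℤ, ‖shiftSeries (rationalWindow a w) c (α * k)‖ ^ 2 ∧
        ∑' k : ℤ, ‖shiftSeries (rationalWindow a w) c (α * k)‖ ^ 2 ≤ B * ‖c‖ ^ 2) := by
  set g := rationalWindow a w
  -- The comparison of `‖f_c‖₂` with `‖c‖` does not depend on `α`. It is obtained from an auxiliary
  -- irrational lattice `γℤ`, since `α` itself may be rational.
  obtain ⟨γ, hγ, hγ0, hγ1⟩ := exists_irrational_btwn (zero_lt_one' ℝ)
  obtain ⟨A₁, hA₁, hlow₁⟩ := exists_lower_bound a w hw hW hm hγ0 hγ1 hγ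
  obtain ⟨B₁, hB₁, hup₁⟩ := hW.exists_upper_bound hγ0
  obtain ⟨B, hB, hup⟩ := hW.exists_upper_bound hα0
  have hL2 : ∀ c : lp (fun _ : ℤ => ℂ) 2, MemLp (shiftSeries g c) 2 volume ∧
      γ * (A₁ * ‖c‖ ^ 2) ≤ ∫ t, ‖shiftSeries g c t‖ ^ 2 ∧
      ∫ t, ‖shiftSeries g c t‖ ^ 2 ≤ γ * (B₁ * ‖c‖ ^ 2) := by
    intro c
    have hc := lp_two_norm_sq c
    obtain ⟨hs, hb⟩ := hup₁ _ hc.summable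
    rw [hc.tsum_eq] at hb
    have hl := fun x => hlow₁ x _ hc.summable
    rw [hc.tsum_eq] at hl
    exact memLp_two_of_lattice_bounds (measurable_shiftSeries hW.1 c hs) hγ0 (by positivity)
      (fun x => (hb x).1) hl fun x => (hb x).2
  have hupper : ∀ c : lp (fun _ : ℤ => ℂ) 2,
      Summable (fun k : ℤ => ‖shiftSeries g c (α * k)‖ ^ 2) ∧
      ∑' k : ℤ, ‖shiftSeries g c (α * k)‖ ^ 2 ≤ B * ‖c‖ ^ 2 := by
    intro c
    have hc := lp_two_norm_sq c
    have hb := (hup _ hc.summable).2 0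
    rw [hc.tsum_eq] at hb
    simp only [zero_add] at hb
    exact hb
  have hupperL2 : ∀ c : lp (fun _ : ℤ => ℂ) 2, ∑' k : ℤ, ‖shiftSeries g c (α * k)‖ ^ 2 ≤
      B / (γ * A₁) * ∫ t, ‖shiftSeries g c t‖ ^ 2 := by
    intro c
    refine (hupper c).2.trans ?_
    rw [div_mul_eq_mul_div, mul_div_assoc]
    refine mul_le_mul_of_nonneg_left ?_ hB.le
    rw [le_div_iff₀ (by positivity)]
    linarith [(hL2 c).2.1]
  refine ⟨fun c => ⟨(hup _ (lp_two_norm_sq c).summable).1, (hL2 c).1⟩, ?_, fun hα => ?_⟩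
  -- One constant must serve both upper bounds, so the two are added.
  · refine ⟨B + B / (γ * A₁), by positivity, fun c => ⟨(hupper c).1, (hupper c).2.trans ?_,
      (hupperL2 c).trans ?_⟩⟩
    · exact mul_le_mul_of_nonneg_right (le_add_of_nonneg_right (by positivity)) (by positivity)
    · exact mul_le_mul_of_nonneg_right (le_add_of_nonneg_left hB.le)
        (integral_nonneg fun _ => by positivity)
  · obtain ⟨A, hA, hlow⟩ := exists_lower_bound a w hw hW hm hα0 hα1 hα
    have hlower : ∀ c : lp (fun _ : ℤ => ℂ) 2,
        A * ‖c‖ ^ 2 ≤ ∑' k : ℤ, ‖shiftSeries g c (α * k)‖ ^ 2 := by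
      intro c
      have hc := lp_two_norm_sq c
      have hl := hlow 0 _ hc.summable
      rw [hc.tsum_eq] at hl
      simp only [zero_add] at hl
      exact hl
    refine ⟨⟨isSeparatedSet_lattice hα0, A / (γ * B₁), B / (γ * A₁), by positivity, by positivity,
      ?_⟩, A, B, hA, hB, fun c => ⟨(hupper c).1, hlower c, (hupper c).2⟩⟩
    rintro _ ⟨c, rfl⟩
    obtain ⟨hsum, htsum⟩ := sum_lattice_eq hα0 (shiftSeries g c)
    refine ⟨(hL2 c).1, hsum.2 (hupper c).1, ?_, ?_⟩
    · rw [htsum]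
      refine le_trans ?_ (hlower c)
      rw [div_mul_eq_mul_div, mul_div_assoc]
      refine mul_le_mul_of_nonneg_left ?_ hA.le
      rw [div_le_iff₀ (by positivity)]
      linarith [(hL2 c).2.2]
    · rw [htsum]
      exact hupperL2 c
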